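/- Let $K$ be an ordered field. Write $GL_+(2,K)$ for the group of $2\times 2$ matrices over $K$ with positive determinant, $PSL(2,K)$ for $SL(2,K)$ modulo its centre, $PGL_+(2,K)=GL_+(2,K)/\{\lambda I:\lambda\in K^\times\}$ and $P_+GL_+(2,K)=GL_+(2,K)/\{\lambda I:\lambda>0\}$. *Tautological classes.* Let a group $G$ act by simplicial automorphisms on an acyclic simplicial complex $X$, and let $C_*X$ be its complex of alternating simplicial chains, with boundaries $B_*X$. Put $U_2=(C_2X/B_2X)_G$ (coinvariants), and let $T:C_2X\to U_2$ be the quotient map. The pull-back of the cocycle $T$ under a $G$-equivariant augmentation-preserving chain map from the standard resolution of $\mathbf Z$ to $C_*X$ represents a class in $H^2(G,U_2)$ (trivial action on $U_2$), which does not depend on the chain map; it is called the tautological class of the action. *The classes.* Let $X$ be the complex with vertex set the projective line $\mathbf P^1(K)$ in which every non-empty finite set of points is a simplex; let $X_+$ be the complex with vertex set $\mathbf P^1_+(K)=(K^2\setminus\{0\})/K_{>0}$ whose simplices are the non-empty finite sets of points represented by pairwise linearly independent vectors. Both are acyclic. For a $2$-simplex $([v_1],[v_2],[v_3])$ of $X$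 or of $X_+$ write $v_3=\alpha_1v_1+\alpha_2v_2$, and put $s=\operatorname{sgn}\det(v_1,v_2)$. * The Witt class $w\in H^2(PSL(2,K),W(K))$, where $W(K)$ is the Witt group of non-degenerate symmetric bilinear forms over $K$ and $[\lambda]$ is the class of the form $\lambda xy$ on $K$, is the image of the tautological class of the action of $PSL(2,K)$ on $X$ under the homomorphism $U_2\to W(K)$ given by $([u],[v],[w])\mapsto[\det(u,v)\det(v,w)\det(w,u)]$. * The Euler class $eu\in H^2(PGL_+(2,K),\mathbf Z)$ is the image of the tautological class of the action of $PGL_+(2,K)$ on $X$ under the homomorphism $U_2\to\mathbf Z$ given by $([v_1],[v_2],[v_3])\mapsto\operatorname{sgn}(\det(v_1,v_2)\,\alpha_1\alpha_2)$. * The class $eu_0\in H^2(P_+GL_+(2,K),\mathbf Z)$ is the image of the tautological class of the action of $P_+GL_+(2,K)$ on $X_+$ under the homomorphism $U_2\to\mathbf Z$ sending $([v_1],[v_2],[v_3])$ to $s$ if $\alpha_1<0$ and $\alpha_2<0$, and to $0$ otherwise. **Theorem.** Let $\phi:PSL(2,K)\to PGL_+(2,K)$ be the standard inclusion, and let $\sigma:W(K)\to\mathbf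 Z$ be the signature. Then $$\phi^*eu=\sigma_*w\quad\text{in } H^2(PSL(2,K),\mathbf Z).$$ Moreover, in $H^2(SL(2,K),\mathbf Z)$, the pull-back of this class along $SL(2,K)\to PSL(2,K)$ equals $4\,eu_0$, where $eu_0$ is pulled back along the natural map $SL(2,K)\to P_+GL_+(2,K)$. -/

import Mathlib

open CategoryTheory
open scoped MatrixGroups LinearAlgebra.Projectivization

universe u

namespace FlatEuler

noncomputable section

/-! ### Alternating simplicial chains -/

section Chains

variable {V : Type u} (X : AbstractSimplicialComplex V)

/-- Non-degenerate ordered `n`-simplices: injective `(n+1)`-tuples of vertices spanning a face. -/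
def OrderedSimplex (n : ℕ) : Type u :=
  {σ : Fin (n + 1) ↪ V // Finset.univ.map σ ∈ X.faces}

variable {X}

/-- The vertex tuple of an ordered simplex. -/
def OrderedSimplex.vertex {n : ℕ} (σ : OrderedSimplex X n) (i : Fin (n + 1)) : V := σ.1 i

theorem OrderedSimplex.ext {n : ℕ} {σ τ : OrderedSimplex X n}
    (h : ∀ i, σ.vertex i = τ.vertex i) : σ = τ :=
  Subtype.ext (DFunLike.ext _ _ h)

/-- Permuting the vertices of an ordered simplex. -/
def OrderedSimplex.perm {n : ℕ} (σ : OrderedSimplex X n) (t : Equiv.Perm (Fin (n + 1))) :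
    OrderedSimplex X n :=
  ⟨t.toEmbedding.trans σ.1, by
    rw [← Finset.map_map, Finset.map_univ_equiv]
    exact σ.2⟩

/-- Omitting the `i`-th vertex of an ordered simplex. -/
def OrderedSimplex.face {n : ℕ} (σ : OrderedSimplex X (n + 1)) (i : Fin (n + 2)) :
    OrderedSimplex X n :=
  ⟨(Fin.succAboveEmb i).trans σ.1, by
    refine (X.isRelLowerSet_faces σ.2).2 ?_ (by simp)
    rw [← Finset.map_map]
    exact Finset.map_subset_map.2 (Finset.subset_univ _)⟩

variable (X)

/-- The relations `σ ∘ t = sgn(t) σ`, for `t` a permutation of the vertices of `σ`. -/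
def alternation (n : ℕ) : AddSubgroup (FreeAbelianGroup (OrderedSimplex X n)) :=
  AddSubgroup.closure {x | ∃ (σ : OrderedSimplex X n) (t : Equiv.Perm (Fin (n + 1))),
    x = FreeAbelianGroup.of (σ.perm t) - (Equiv.Perm.sign t : ℤ) • FreeAbelianGroup.of σ}

/-- The group `C_n X` of alternating simplicial `n`-chains. -/
abbrev Chain (n : ℕ) : Type u := FreeAbelianGroup (OrderedSimplex X n) ⧸ alternation X n

variable {X}

/-- The chain of an ordered simplex. -/
def Chain.of {n : ℕ} (σ : OrderedSimplex X n) : Chain X n :=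
  QuotientAddGroup.mk' (alternation X n) (FreeAbelianGroup.of σ)

theorem Chain.of_perm {n : ℕ} (σ : OrderedSimplex X n) (t : Equiv.Perm (Fin (n + 1))) :
    Chain.of (σ.perm t) = (Equiv.Perm.sign t : ℤ) • Chain.of σ := by
  unfold Chain.of
  rw [← map_zsmul]
  refine (QuotientAddGroup.mk'_eq_mk' _).2 ⟨-(FreeAbelianGroup.of (σ.perm t) -
    (Equiv.Perm.sign t : ℤ) • FreeAbelianGroup.of σ), ?_, by abel⟩
  exact neg_mem (AddSubgroup.subset_closure ⟨σ, t, rfl⟩)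

theorem Chain.induction {n : ℕ} {P : Chain X n → Prop} (c : Chain X n) (zero : P 0)
    (of : ∀ σ, P (Chain.of σ)) (neg : ∀ c, P c → P (-c))
    (add : ∀ c d, P c → P d → P (c + d)) : P c := by
  obtain ⟨x, rfl⟩ := QuotientAddGroup.mk'_surjective (alternation X n) c
  induction x using FreeAbelianGroup.induction_on with
  | zero => exact zero
  | of σ => exact of σ
  | neg σ _ => exact neg _ (of σ)
  | add x y hx hy => exact add _ _ hx hy

/-- An alternating function on ordered simplices extends to chains. -/
def Chain.lift {n : ℕ} {A : Type*} [AddCommGroup A] (f : OrderedSimplex X n → A)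
    (hf : ∀ σ t, f (σ.perm t) = (Equiv.Perm.sign t : ℤ) • f σ) : Chain X n →+ A :=
  QuotientAddGroup.lift (alternation X n) (FreeAbelianGroup.lift f) (by
    rw [alternation, AddSubgroup.closure_le]
    rintro _ ⟨σ, t, rfl⟩
    simp [hf])

@[simp]
theorem Chain.lift_of {n : ℕ} {A : Type*} [AddCommGroup A] (f : OrderedSimplex X n → A)
    (hf : ∀ σ t, f (σ.perm t) = (Equiv.Perm.sign t : ℤ) • f σ) (σ : OrderedSimplex X n) :
    Chain.lift f hf (Chain.of σ) = f σ := by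
  change FreeAbelianGroup.lift f (FreeAbelianGroup.of σ) = f σ
  simp

theorem Chain.hom_ext {n : ℕ} {A : Type*} [AddCommGroup A] {f g : Chain X n →+ A}
    (h : ∀ σ, f (Chain.of σ) = g (Chain.of σ)) : f = g := by
  refine DFunLike.ext _ _ fun c => ?_
  induction c using Chain.induction with
  | zero => simp
  | of σ => exact h σ
  | neg c hc => simp [hc]
  | add c d hc hd => simp [hc, hd]

/-- Permuting and then omitting a vertex. -/
theorem exists_face_perm {n : ℕ} (t : Equiv.Perm (Fin (n + 2))) (i : Fin (n + 2)) :
    ∃ s : Equiv.Perm (Fin (n + 1)),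
      (∀ j, t (i.succAbove j) = (t i).succAbove (s j)) ∧
      (-1 : ℤ) ^ (i : ℕ) * (Equiv.Perm.sign s : ℤ) =
        (Equiv.Perm.sign t : ℤ) * (-1) ^ ((t i : Fin (n + 2)) : ℕ) := by
  obtain ⟨⟨p, s⟩, hps⟩ := Equiv.Perm.decomposeFin.symm.surjective
    (i.cycleRange.symm.trans (t.trans (t i).cycleRange))
  have hp : p = 0 := by
    have h := congrArg (fun e : Equiv.Perm (Fin (n + 2)) => e 0) hps
    simpa using h
  subst hp
  refine ⟨s, fun j => ?_, ?_⟩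
  · have h := congrArg (fun e : Equiv.Perm (Fin (n + 2)) => e j.succ) hps
    simp only [Equiv.Perm.decomposeFin_symm_apply_succ, Equiv.swap_self, Equiv.refl_apply,
      Equiv.trans_apply, Fin.cycleRange_symm_succ] at h
    rw [← Fin.cycleRange_symm_succ (t i), h, Equiv.symm_apply_apply]
  · have h := congrArg (fun e : Equiv.Perm (Fin (n + 2)) => (Equiv.Perm.sign e : ℤ)) hps
    simp only [Equiv.Perm.decomposeFin.symm_sign, if_true, one_mul, Equiv.Perm.sign_trans,
      Equiv.Perm.sign_symm, Fin.sign_cycleRange] at h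
    rw [h]
    have h1 : ((-1 : ℤ) ^ (i : ℕ)) * (-1) ^ (i : ℕ) = 1 := by
      rw [← mul_pow]; simp
    push_cast
    linear_combination ((-1 : ℤ) ^ ((t i : Fin (n + 2)) : ℕ) * (Equiv.Perm.sign t : ℤ)) * h1

/-- The boundary operator `∂[v_0, …, v_{n+1}] = ∑ (-1)^i [v_0, …, v̂_i, …, v_{n+1}]`. -/
def boundary (n : ℕ) : Chain X (n + 1) →+ Chain X n :=
  Chain.lift (fun σ => ∑ i : Fin (n + 2), (-1 : ℤ) ^ (i : ℕ) • Chain.of (σ.face i)) (by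
    intro σ t
    rw [Finset.smul_sum]
    refine Eq.trans ?_ (Equiv.sum_comp t _)
    refine Finset.sum_congr rfl fun i _ => ?_
    obtain ⟨s, hs, hsign⟩ := exists_face_perm t i
    have h : (σ.perm t).face i = (σ.face (t i)).perm s :=
      OrderedSimplex.ext fun j => congrArg σ.1 (hs j)
    rw [h, Chain.of_perm, smul_smul, smul_smul, hsign])

theorem boundary_of {n : ℕ} (σ : OrderedSimplex X (n + 1)) :
    boundary n (Chain.of σ) = ∑ i : Fin (n + 2), (-1 : ℤ) ^ (i : ℕ) • Chain.of (σ.face i) :=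
  Chain.lift_of _ _ _

variable (X) in
/-- The augmentation `C_0 X → ℤ`, sending every vertex to `1`. -/
def augmentation : Chain X 0 →+ ℤ :=
  Chain.lift (fun _ => 1) (by
    intro σ t
    rw [show t = 1 from Equiv.ext fun i => Subsingleton.elim (α := Fin 1) _ _]
    simp)

@[simp]
theorem augmentation_of (σ : OrderedSimplex X 0) : augmentation X (Chain.of σ) = 1 :=
  Chain.lift_of _ _ _

variable (X) in
/-- `X` is acyclic: `⋯ → C_1 X → C_0 X → ℤ → 0` is exact. -/
structure IsAcyclic : Prop where
  augmentation_surjective : Function.Surjective (augmentation X)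
  exact_zero : ∀ c : Chain X 0, augmentation X c = 0 → ∃ d, boundary 0 d = c
  exact_succ : ∀ (n : ℕ) (c : Chain X (n + 1)), boundary n c = 0 → ∃ d, boundary (n + 1) d = c

/-- The cancellation behind `∂ ∂ = 0`. -/
theorem sum_face_face {α A : Type*} [AddCommGroup A] {n : ℕ} (f : (Fin n → α) → A)
    (v : Fin (n + 2) → α) :
    ∑ i : Fin (n + 2), (-1 : ℤ) ^ (i : ℕ) • ∑ j : Fin (n + 1), (-1 : ℤ) ^ (j : ℕ) •
      f (fun k => v (i.succAbove (j.succAbove k))) = 0 := by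
  simp only [Finset.smul_sum, smul_smul, ← pow_add]
  rw [Fin.sum_sum_eq_sum_triangle_add]
  refine Finset.sum_eq_zero fun i _ => Finset.sum_eq_zero fun j hj => ?_
  rw [Finset.mem_Ici] at hj
  have h : ∀ k : Fin n, i.castSucc.succAbove (j.succAbove k) = j.succ.succAbove (i.succAbove k) := by
    intro k
    have := congrFun (Fin.removeNth_removeNth_eq_swap (fun x : Fin (n + 2) => x) j i.castSucc) k
    simpa [Fin.removeNth_apply, Fin.predAbove, not_lt.2 hj, hj, Fin.succAbove_of_le_castSucc]
      using this
  simp [h, pow_add, add_comm]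

/-- `v` is joinable with the face `s`. -/
def IsJoinable (X : AbstractSimplicialComplex V) (v : V) (s : Finset V) : Prop :=
  ∃ h : v ∉ s, Finset.cons v s h ∈ X.faces

variable (X) in
/-- The star property: for every finite set `F` of vertices there is a vertex outside `F` which is
joinable with every simplex of `X` whose vertices lie in `F`. -/
def HasStarProperty : Prop :=
  ∀ F : Finset V, ∃ v, v ∉ F ∧ ∀ s ∈ X.faces, s ⊆ F → IsJoinable X v s

/-- The ordered simplex `v * σ`. -/
def OrderedSimplex.join {n : ℕ} (v : V) (σ : OrderedSimplex X n)
    (h : IsJoinable X v (Finset.univ.map σ.1)) : OrderedSimplex X (n + 1) :=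
  ⟨⟨Fin.cons v σ.1, Fin.cons_injective_iff.2 ⟨by
      rintro ⟨i, hi⟩
      exact h.1 (Finset.mem_map.2 ⟨i, Finset.mem_univ _, hi⟩), σ.1.injective⟩⟩, by
    obtain ⟨h1, h2⟩ := h
    convert h2
    ext x
    simp only [Finset.mem_map, Finset.mem_univ, true_and, Function.Embedding.coeFn_mk,
      Fin.exists_fin_succ, Fin.cons_zero, Fin.cons_succ, Finset.mem_cons, eq_comm]⟩

theorem OrderedSimplex.map_perm {n : ℕ} (σ : OrderedSimplex X n)
    (t : Equiv.Perm (Fin (n + 1))) : Finset.univ.map (σ.perm t).1 = Finset.univ.map σ.1 := by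
  change Finset.univ.map (t.toEmbedding.trans σ.1) = _
  rw [← Finset.map_map, Finset.map_univ_equiv]

theorem IsJoinable.subset {v : V} {s t : Finset V} (h : IsJoinable X v s) (hts : t ⊆ s) :
    IsJoinable X v t :=
  ⟨fun hv => h.1 (hts hv), (X.isRelLowerSet_faces h.2).2
    (Finset.cons_subset_cons.2 hts) (Finset.cons_nonempty _)⟩

open Classical in
/-- The cone operator `σ ↦ v * σ`. -/
def cone (v : V) (n : ℕ) : Chain X n →+ Chain X (n + 1) :=
  Chain.lift (fun σ => if h : IsJoinable X v (Finset.univ.map σ.1) then Chain.of (σ.join v h)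
    else 0) (by
    intro σ t
    by_cases h : IsJoinable X v (Finset.univ.map σ.1)
    · have h' : IsJoinable X v (Finset.univ.map (σ.perm t).1) := by
        rwa [OrderedSimplex.map_perm]
      rw [dif_pos h, dif_pos h']
      have e : (σ.perm t).join v h' =
          (σ.join v h).perm (Equiv.Perm.decomposeFin.symm (0, t)) := by
        refine OrderedSimplex.ext fun i => ?_
        refine Fin.cases ?_ (fun j => ?_) i
        · change _ = Fin.cons (α := fun _ => V) v σ.1 (Equiv.Perm.decomposeFin.symm (0, t) 0)
          rw [Equiv.Perm.decomposeFin_symm_apply_zero]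
          rfl
        · change _ = Fin.cons (α := fun _ => V) v σ.1 (Equiv.Perm.decomposeFin.symm (0, t) j.succ)
          rw [Equiv.Perm.decomposeFin_symm_apply_succ, Equiv.swap_self, Equiv.refl_apply]
          rfl
      rw [e, Chain.of_perm]
      simp
    · have h' : ¬ IsJoinable X v (Finset.univ.map (σ.perm t).1) := by
        rwa [OrderedSimplex.map_perm]
      rw [dif_neg h, dif_neg h', smul_zero])

theorem cone_of {v : V} {n : ℕ} {σ : OrderedSimplex X n}
    (h : IsJoinable X v (Finset.univ.map σ.1)) :
    cone v n (Chain.of σ) = Chain.of (σ.join v h) := by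
  rw [cone, Chain.lift_of, dif_pos h]

/-- `v` is joinable with all simplices on vertices in `F`. -/
def IsApex (X : AbstractSimplicialComplex V) (F : Finset V) (v : V) : Prop :=
  ∀ s ∈ X.faces, s ⊆ F → IsJoinable X v s

theorem boundary_cone_succ {n : ℕ} (c : Chain X (n + 1)) : ∃ F : Finset V, ∀ v,
    IsApex X F v → boundary (n + 1) (cone v (n + 1) c) + cone v n (boundary n c) = c := by
  classical
  induction c using Chain.induction with
  | zero => exact ⟨∅, fun v _ => by simp⟩
  | neg c hc =>
    obtain ⟨F, hF⟩ := hc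
    refine ⟨F, fun v hv => ?_⟩
    rw [map_neg, map_neg, map_neg, map_neg, ← neg_add, hF v hv]
  | add c d hc hd =>
    obtain ⟨F, hF⟩ := hc
    obtain ⟨F', hF'⟩ := hd
    refine ⟨F ∪ F', fun v hv => ?_⟩
    have h1 := hF v fun s hs h => hv s hs (h.trans Finset.subset_union_left)
    have h2 := hF' v fun s hs h => hv s hs (h.trans Finset.subset_union_right)
    rw [map_add, map_add, map_add, map_add, add_add_add_comm, h1, h2]
  | of σ =>
    refine ⟨Finset.univ.map σ.1, fun v hv => ?_⟩
    have h := hv _ σ.2 subset_rfl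
    rw [cone_of h, boundary_of, boundary_of, Fin.sum_univ_succ, map_sum, add_assoc,
      ← Finset.sum_add_distrib]
    have h0 : (σ.join v h).face 0 = σ := OrderedSimplex.ext fun i => rfl
    rw [h0, Finset.sum_eq_zero]
    · simp
    · intro i _
      have hi : IsJoinable X v (Finset.univ.map (σ.face i).1) := by
        refine h.subset ?_
        change Finset.univ.map ((Fin.succAboveEmb i).trans σ.1) ⊆ _
        rw [← Finset.map_map]
        exact Finset.map_subset_map.2 (Finset.subset_univ _)
      have e : (σ.join v h).face i.succ = (σ.face i).join v hi := by
        refine OrderedSimplex.ext fun j => ?_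
        refine Fin.cases ?_ (fun k => ?_) j
        · change Fin.cons (α := fun _ => V) v σ.1 (i.succ.succAbove 0) = v
          rw [Fin.succ_succAbove_zero]
          rfl
        · change Fin.cons (α := fun _ => V) v σ.1 (i.succ.succAbove k.succ) = _
          rw [Fin.succ_succAbove_succ]
          rfl
      rw [e, map_zsmul, cone_of hi, Fin.val_succ, pow_succ]
      simp

theorem boundary_cone_zero (c : Chain X 0) : ∃ F : Finset V, ∀ v (σ : OrderedSimplex X 0),
    σ.vertex 0 = v → IsApex X F v →
      boundary 0 (cone v 0 c) + augmentation X c • Chain.of σ = c := by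
  classical
  induction c using Chain.induction with
  | zero => exact ⟨∅, fun v _ _ _ => by simp⟩
  | neg c hc =>
    obtain ⟨F, hF⟩ := hc
    refine ⟨F, fun v σ hσ hv => ?_⟩
    rw [map_neg, map_neg, map_neg, neg_smul, ← neg_add, hF v σ hσ hv]
  | add c d hc hd =>
    obtain ⟨F, hF⟩ := hc
    obtain ⟨F', hF'⟩ := hd
    refine ⟨F ∪ F', fun v σ hσ hv => ?_⟩
    have h1 := hF v σ hσ fun s hs h => hv s hs (h.trans Finset.subset_union_left)
    have h2 := hF' v σ hσ fun s hs h => hv s hs (h.trans Finset.subset_union_right)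
    rw [map_add, map_add, map_add, add_smul, add_add_add_comm, h1, h2]
  | of τ =>
    refine ⟨Finset.univ.map τ.1, fun v σ hσ hv => ?_⟩
    have h := hv _ τ.2 subset_rfl
    rw [cone_of h, boundary_of, Fin.sum_univ_two, augmentation_of]
    have h0 : (τ.join v h).face 0 = τ := OrderedSimplex.ext fun i => rfl
    have h1 : (τ.join v h).face 1 = σ := by
      refine OrderedSimplex.ext fun i => ?_
      have hi : i = 0 := Subsingleton.elim (α := Fin 1) _ _
      subst hi
      rw [hσ]
      rfl
    rw [h0, h1]
    simp

variable (X) in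
/-- A vertex as an ordered `0`-simplex. -/
def OrderedSimplex.point (v : V) : OrderedSimplex X 0 :=
  ⟨⟨fun _ => v, fun _ _ _ => Subsingleton.elim (α := Fin 1) _ _⟩, by
    convert X.singleton_mem v
    exact Finset.map_singleton _ (0 : Fin 1)⟩

/-- A complex with the star property is acyclic. -/
theorem HasStarProperty.isAcyclic (h : HasStarProperty X) : IsAcyclic X where
  augmentation_surjective k := by
    obtain ⟨v, _⟩ := h ∅
    refine ⟨k • Chain.of (OrderedSimplex.point X v), ?_⟩
    rw [map_zsmul, augmentation_of, smul_eq_mul, mul_one]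
  exact_zero c hc := by
    obtain ⟨F, hF⟩ := boundary_cone_zero c
    obtain ⟨v, _, hv⟩ := h F
    have := hF v (OrderedSimplex.point X v) rfl hv
    rw [hc, zero_smul, add_zero] at this
    exact ⟨_, this⟩
  exact_succ n c hc := by
    obtain ⟨F, hF⟩ := boundary_cone_succ c
    obtain ⟨v, _, hv⟩ := h F
    have := hF v hv
    rw [hc, map_zero, add_zero] at this
    exact ⟨_, this⟩

end Chains

/-! ### Group actions and tautological classes -/

section Tautological

variable {G V : Type u} [Group G] [MulAction G V] {X : AbstractSimplicialComplex V}

/-- `G` acts on `X` by simplicial automorphisms. -/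
def IsInvariant (G : Type u) [Group G] [MulAction G V] (X : AbstractSimplicialComplex V) : Prop :=
  ∀ g : G, ∀ s ∈ X.faces, s.map (MulAction.toPerm g).toEmbedding ∈ X.faces

/-- The action of `G` on ordered simplices. -/
def OrderedSimplex.act (hG : IsInvariant G X) (g : G) {n : ℕ} (σ : OrderedSimplex X n) :
    OrderedSimplex X n :=
  ⟨σ.1.trans (MulAction.toPerm g).toEmbedding, by
    rw [← Finset.map_map]
    exact hG g _ σ.2⟩

/-- The action of `G` on chains. -/
def Chain.act (hG : IsInvariant G X) (g : G) {n : ℕ} : Chain X n →+ Chain X n :=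
  Chain.lift (fun σ => Chain.of (σ.act hG g)) (fun σ t => Chain.of_perm (σ.act hG g) t)

theorem Chain.act_of (hG : IsInvariant G X) (g : G) {n : ℕ} (σ : OrderedSimplex X n) :
    Chain.act hG g (Chain.of σ) = Chain.of (σ.act hG g) :=
  Chain.lift_of _ _ _

theorem Chain.act_mul (hG : IsInvariant G X) (g h : G) {n : ℕ} (c : Chain X n) :
    Chain.act hG (g * h) c = Chain.act hG g (Chain.act hG h c) := by
  refine DFunLike.congr_fun (f := Chain.act hG (g * h))
    (g := (Chain.act hG g).comp (Chain.act hG h)) (Chain.hom_ext fun σ => ?_) c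
  rw [AddMonoidHom.comp_apply, Chain.act_of, Chain.act_of, Chain.act_of]
  exact congrArg _ (OrderedSimplex.ext fun i => mul_smul g h _)

theorem boundary_act (hG : IsInvariant G X) (g : G) {n : ℕ} (c : Chain X (n + 1)) :
    boundary n (Chain.act hG g c) = Chain.act hG g (boundary n c) := by
  refine DFunLike.congr_fun (f := (boundary n).comp (Chain.act hG g))
    (g := (Chain.act hG g).comp (boundary n)) (Chain.hom_ext fun σ => ?_) c
  rw [AddMonoidHom.comp_apply, AddMonoidHom.comp_apply, Chain.act_of, boundary_of, boundary_of,
    map_sum]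
  refine Finset.sum_congr rfl fun i _ => ?_
  rw [map_zsmul, Chain.act_of]
  rfl

theorem augmentation_act (hG : IsInvariant G X) (g : G) (c : Chain X 0) :
    augmentation X (Chain.act hG g c) = augmentation X c := by
  refine DFunLike.congr_fun (f := (augmentation X).comp (Chain.act hG g))
    (g := augmentation X) (Chain.hom_ext fun σ => ?_) c
  rw [AddMonoidHom.comp_apply, Chain.act_of, augmentation_of, augmentation_of]

/-- The subgroup of `C_d X` generated by the boundaries and by all `g c - c`. -/
def coeffRelations (hG : IsInvariant G X) (d : ℕ) : AddSubgroup (Chain X d) :=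
  (boundary d).range ⊔ AddSubgroup.closure {x | ∃ (g : G) (c : Chain X d),
    x = Chain.act hG g c - c}

/-- The coefficient group `U_d(X) = (C_d X / B_d X)_G`, the coinvariants of chains modulo
boundaries. -/
abbrev Coeff (hG : IsInvariant G X) (d : ℕ) : Type u := Chain X d ⧸ coeffRelations hG d

/-- The tautological cocycle `C_d X → U_d(X)`. -/
def tautological (hG : IsInvariant G X) (d : ℕ) : Chain X d →+ Coeff hG d :=
  QuotientAddGroup.mk' (coeffRelations hG d)

theorem tautological_boundary (hG : IsInvariant G X) (d : ℕ) (c : Chain X (d + 1)) :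
    tautological hG d (boundary d c) = 0 :=
  (QuotientAddGroup.eq_zero_iff _).2 (AddSubgroup.mem_sup_left ⟨c, rfl⟩)

theorem tautological_act (hG : IsInvariant G X) (d : ℕ) (g : G) (c : Chain X d) :
    tautological hG d (Chain.act hG g c) = tautological hG d c := by
  rw [← sub_eq_zero, ← map_sub]
  exact (QuotientAddGroup.eq_zero_iff _).2
    (AddSubgroup.mem_sup_right (AddSubgroup.subset_closure ⟨g, c, rfl⟩))

/-- The homomorphism `U_d(X) → A` induced by an alternating `G`-invariant function on ordered
simplices which vanishes on boundaries. -/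
def Coeff.lift (hG : IsInvariant G X) {d : ℕ} {A : Type*} [AddCommGroup A]
    (f : OrderedSimplex X d → A)
    (hf : ∀ σ t, f (σ.perm t) = (Equiv.Perm.sign t : ℤ) • f σ)
    (hact : ∀ g σ, f (σ.act hG g) = f σ)
    (hbd : ∀ σ : OrderedSimplex X (d + 1), ∑ i : Fin (d + 2), (-1 : ℤ) ^ (i : ℕ) • f (σ.face i) = 0) :
    Coeff hG d →+ A :=
  QuotientAddGroup.lift (coeffRelations hG d) (Chain.lift f hf) (by
    rw [coeffRelations, sup_le_iff, AddSubgroup.closure_le]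
    constructor
    · rintro _ ⟨c, rfl⟩
      refine DFunLike.congr_fun (f := (Chain.lift f hf).comp (boundary d)) (g := 0)
        (Chain.hom_ext fun σ => ?_) c
      rw [AddMonoidHom.comp_apply, boundary_of, map_sum, AddMonoidHom.zero_apply, ← hbd σ]
      exact Finset.sum_congr rfl fun i _ => by rw [map_zsmul, Chain.lift_of]
    · rintro _ ⟨g, c, rfl⟩
      have : Chain.lift f hf (Chain.act hG g c) = Chain.lift f hf c := by
        refine DFunLike.congr_fun (f := (Chain.lift f hf).comp (Chain.act hG g))
          (g := Chain.lift f hf) (Chain.hom_ext fun σ => ?_) c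
        rw [AddMonoidHom.comp_apply, Chain.act_of, Chain.lift_of, Chain.lift_of, hact]
      simp [this])

@[simp]
theorem Coeff.lift_tautological (hG : IsInvariant G X) {d : ℕ} {A : Type*} [AddCommGroup A]
    (f : OrderedSimplex X d → A)
    (hf : ∀ σ t, f (σ.perm t) = (Equiv.Perm.sign t : ℤ) • f σ)
    (hact : ∀ g σ, f (σ.act hG g) = f σ)
    (hbd : ∀ σ : OrderedSimplex X (d + 1), ∑ i : Fin (d + 2), (-1 : ℤ) ^ (i : ℕ) • f (σ.face i) = 0)
    (σ : OrderedSimplex X d) :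
    Coeff.lift hG f hf hact hbd (tautological hG d (Chain.of σ)) = f σ :=
  Chain.lift_of f hf σ

/-- An augmentation-preserving `G`-chain map from the standard homogeneous resolution of `ℤ` (the
free abelian groups `ℤ[G^{n+1}]` with diagonal `G`-action) to `C_* X`, given by its values on the
standard bases. -/
structure StandardChainMap (hG : IsInvariant G X) where
  toFun : (n : ℕ) → (Fin (n + 1) → G) → Chain X n
  equivariant : ∀ (n : ℕ) (g : G) (t : Fin (n + 1) → G),
    toFun n (fun i => g * t i) = Chain.act hG g (toFun n t)
  augmentation_eq : ∀ t : Fin 1 → G, augmentation X (toFun 0 t) = 1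
  boundary_eq : ∀ (n : ℕ) (t : Fin (n + 2) → G),
    boundary n (toFun (n + 1) t) =
      ∑ i : Fin (n + 2), (-1 : ℤ) ^ (i : ℕ) • toFun n (fun j => t (i.succAbove j))

/-- An equivariant function with prescribed equivariant boundary. -/
theorem exists_equivariant_lift (hG : IsInvariant G X) {n : ℕ}
    {D : Type*} (b : Chain X n → D) (act : G → D → D)
    (hb : ∀ g c, b (Chain.act hG g c) = act g (b c))
    (z : (Fin (n + 1) → G) → D) (hz : ∀ g t, z (fun i => g * t i) = act g (z t))
    (hex : ∀ t, ∃ c, b c = z t) :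
    ∃ q : (Fin (n + 1) → G) → Chain X n,
      (∀ g t, q (fun i => g * t i) = Chain.act hG g (q t)) ∧ ∀ t, b (q t) = z t := by
  choose r hr using hex
  refine ⟨fun t => Chain.act hG (t 0) (r fun i => (t 0)⁻¹ * t i), fun g t => ?_, fun t => ?_⟩
  · have e : (fun i => (g * t 0)⁻¹ * (g * t i)) = fun i => (t 0)⁻¹ * t i :=
      funext fun i => by rw [mul_inv_rev, mul_assoc, inv_mul_cancel_left]
    exact (congrArg (fun s => Chain.act hG (g * t 0) (r s)) e).trans (Chain.act_mul hG _ _ _)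
  · have e : (fun i => t 0 * ((t 0)⁻¹ * t i)) = t := funext fun i => mul_inv_cancel_left _ _
    exact (hb _ _).trans ((congrArg _ (hr _)).trans ((hz _ _).symm.trans (congrArg z e)))

/-- The standard resolution maps to any acyclic complex. -/
theorem nonempty_standardChainMap (hG : IsInvariant G X) (hX : IsAcyclic X) :
    Nonempty (StandardChainMap hG) := by
  have h0 : ∃ q : (Fin 1 → G) → Chain X 0,
      (∀ g t, q (fun i => g * t i) = Chain.act hG g (q t)) ∧ ∀ t, augmentation X (q t) = 1 :=
    exists_equivariant_lift hG (augmentation X) (fun _ k => k) (augmentation_act hG) (fun _ => 1)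
      (fun _ _ => rfl) (fun _ => hX.augmentation_surjective 1)
  obtain ⟨q0, hq0, hq0'⟩ := h0
  -- the alternating sum of the faces of a tuple
  let S : (n : ℕ) → ((Fin (n + 1) → G) → Chain X n) → (Fin (n + 2) → G) → Chain X n :=
    fun n p t => ∑ i : Fin (n + 2), (-1 : ℤ) ^ (i : ℕ) • p (fun j => t (i.succAbove j))
  have hS : ∀ n (p : (Fin (n + 1) → G) → Chain X n),
      (∀ g t, p (fun i => g * t i) = Chain.act hG g (p t)) →
      ∀ g t, S n p (fun i => g * t i) = Chain.act hG g (S n p t) := by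
    intro n p hp g t
    simp only [S, map_sum, map_zsmul]
    exact Finset.sum_congr rfl fun i _ => congrArg _ (hp g fun j => t (i.succAbove j))
  let P : (n : ℕ) → Type u := fun n => {p : (Fin (n + 1) → G) → Chain X n //
    (∀ g t, p (fun i => g * t i) = Chain.act hG g (p t)) ∧
    ∀ t, ∃ c, boundary n c = S n p t}
  have step : ∀ n (p : P n), ∃ q : P (n + 1), ∀ t, boundary n (q.1 t) = S n p.1 t := by
    intro n p
    obtain ⟨q, hq, hq'⟩ := exists_equivariant_lift hG (boundary n) (fun g => Chain.act hG g)
      (fun g c => boundary_act hG g c) (S n p.1) (hS n p.1 p.2.1) p.2.2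
    refine ⟨⟨q, hq, fun t => hX.exact_succ n _ ?_⟩, hq'⟩
    simp only [S, map_sum, map_zsmul, hq']
    exact sum_face_face p.1 t
  choose next hnext using step
  let p0 : P 0 := ⟨q0, hq0, fun t => hX.exact_zero _ (by
    simp [S, hq0', Fin.sum_univ_two])⟩
  let p : (n : ℕ) → P n := fun n => Nat.rec p0 (fun n q => next n q) n
  exact ⟨⟨fun n => (p n).1, fun n => (p n).2.1, hq0', fun n t => hnext n (p n) t⟩⟩

/-- `H²(G, A)` for an abelian group `A` with trivial `G`-action. (`ULift` only adjusts the universe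
of the ground ring `ℤ`.) -/
abbrev H2 (G A : Type u) [Group G] [AddCommGroup A] : Type u :=
  groupCohomology.H2 (Rep.trivial (ULift.{u} ℤ) G A)

/-- The pull-back `φ^* : H²(H, A) → H²(G, A)` along a homomorphism `φ : G → H`. -/
def H2.pull {G H : Type u} [Group G] [Group H] (φ : G →* H) {A : Type u} [AddCommGroup A] :
    H2 H A →+ H2 G A :=
  (groupCohomology.map (A := Rep.trivial (ULift.{u} ℤ) H A) (B := Rep.trivial (ULift.{u} ℤ) G A)
    φ (𝟙 (Rep.trivial (ULift.{u} ℤ) G A)) 2).hom.toAddMonoidHom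

/-- An additive map is linear over `ULift ℤ`. -/
def toULiftIntLinear {A B : Type u} [AddCommGroup A] [AddCommGroup B] (f : A →+ B) :
    A →ₗ[ULift.{u} ℤ] B where
  toFun := f
  map_add' := f.map_add
  map_smul' c x := map_zsmul f c.down x

/-- The coefficient map `f_* : H²(G, A) → H²(G, B)` induced by `f : A → B`. -/
def H2.push {G : Type u} [Group G] {A B : Type u} [AddCommGroup A] [AddCommGroup B]
    (f : A →+ B) : H2 G A →+ H2 G B :=
  (groupCohomology.map (A := Rep.trivial (ULift.{u} ℤ) G A)
    (B := Rep.trivial (ULift.{u} ℤ) G B) (MonoidHom.id G)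
    ((Rep.trivialFunctor (ULift.{u} ℤ) G).map (ModuleCat.ofHom (toULiftIntLinear f)))
    2).hom.toAddMonoidHom

/-- The inhomogeneous cocycle `(g, h) ↦ T(ψ_2(1, g, gh))` obtained by pulling the tautological
cocycle `T` back along a chain map `ψ` from the standard resolution. -/
def tautologicalCocycle {hG : IsInvariant G X} (ψ : StandardChainMap hG) :
    groupCohomology.cocycles₂ (Rep.trivial (ULift.{u} ℤ) G (Coeff hG 2)) :=
  ⟨fun gh => tautological hG 2 (ψ.toFun 2 ![1, gh.1, gh.1 * gh.2]), by
    rw [groupCohomology.mem_cocycles₂_iff]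
    intro g h j
    have key := tautological_boundary hG 2 (ψ.toFun 3 ![1, g, g * h, g * h * j])
    have e0 : (fun k : Fin 3 => (![1, g, g * h, g * h * j] : Fin 4 → G) ((0 : Fin 4).succAbove k)) =
        fun i => g * (![1, h, h * j] : Fin 3 → G) i := by
      funext k; fin_cases k <;> simp [Fin.succAbove, mul_assoc]
    have e1 : (fun k : Fin 3 => (![1, g, g * h, g * h * j] : Fin 4 → G) ((1 : Fin 4).succAbove k)) =
        ![1, g * h, g * h * j] := by
      funext k; fin_cases k <;> rfl
    have e2 : (fun k : Fin 3 => (![1, g, g * h, g * h * j] : Fin 4 → G) ((2 : Fin 4).succAbove k)) =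
        ![1, g, g * (h * j)] := by
      funext k; fin_cases k <;> simp [Fin.succAbove, mul_assoc]
    have e3 : (fun k : Fin 3 => (![1, g, g * h, g * h * j] : Fin 4 → G) ((3 : Fin 4).succAbove k)) =
        ![1, g, g * h] := by
      funext k; fin_cases k <;> rfl
    rw [ψ.boundary_eq 2, Fin.sum_univ_four, e0, e1, e2, e3, ψ.equivariant] at key
    simp only [map_add, map_zsmul, tautological_act] at key
    rw [← sub_eq_zero, ← neg_eq_zero, ← key]
    simp
    abel⟩

/-- The tautological class `τ²_{G,X} ∈ H²(G, U_2(X))` of an acyclic simplicial complex `X` with an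
action of `G`. (It does not depend on the chosen chain map, which is unique up to `G`-homotopy.) -/
def tautologicalClass (hG : IsInvariant G X) (hX : IsAcyclic X) : H2 G (Coeff hG 2) :=
  groupCohomology.H2π (Rep.trivial (ULift.{u} ℤ) G (Coeff hG 2))
    (tautologicalCocycle (nonempty_standardChainMap hG hX).some)

end Tautological

/-! ### The Witt group -/

section Witt

variable (K : Type u) [Field K]

/-- A non-degenerate symmetric bilinear form over `K`, of finite dimension; the underlying vector
space is taken to be a standard one, which does not change the set of isometry classes. -/
structure SymForm where
  dim : ℕ
  form : LinearMap.BilinForm K (Fin dim → K)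
  symm : form.IsSymm
  nondegenerate : form.Nondegenerate

variable {K}

/-- `C` is isometric to the orthogonal sum `A ⊥ B`. -/
def IsOrthogonalSum (A B C : SymForm K) : Prop :=
  ∃ e : ((Fin A.dim → K) × (Fin B.dim → K)) ≃ₗ[K] (Fin C.dim → K),
    ∀ p q, C.form (e p) (e q) = A.form p.1 q.1 + B.form p.2 q.2

/-- `C` is isometric to the tensor product of `A` with the hyperbolic plane, i.e. with the form
of matrix `(0 1; 1 0)`. -/
def IsHyperbolicTensor (A C : SymForm K) : Prop :=
  ∃ e : ((Fin A.dim → K) × (Fin A.dim → K)) ≃ₗ[K] (Fin C.dim → K),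
    ∀ p q, C.form (e p) (e q) = A.form p.1 q.2 + A.form p.2 q.1

variable (K)

/-- Relations of the Witt group: `[C] = [A] + [B]` if `C ≅ A ⊥ B`, giving the Grothendieck group of
isometry classes, and `[C] = 0` if `C` is isometric to `A ⊗ (hyperbolic plane)`, i.e. lies in the
ideal generated by the hyperbolic plane. -/
def wittRelations : AddSubgroup (FreeAbelianGroup (SymForm K)) :=
  AddSubgroup.closure
    ({x | ∃ A B C : SymForm K, IsOrthogonalSum A B C ∧
        x = FreeAbelianGroup.of C - FreeAbelianGroup.of A - FreeAbelianGroup.of B} ∪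
     {x | ∃ A C : SymForm K, IsHyperbolicTensor A C ∧ x = FreeAbelianGroup.of C})

/-- The Witt group `W(K)` of non-degenerate symmetric bilinear forms over `K`. -/
abbrev WittGroup : Type u := FreeAbelianGroup (SymForm K) ⧸ wittRelations K

variable {K}

/-- The Witt class of a form. -/
def WittGroup.of (A : SymForm K) : WittGroup K :=
  QuotientAddGroup.mk' (wittRelations K) (FreeAbelianGroup.of A)

theorem WittGroup.of_orthogonalSum {A B C : SymForm K} (h : IsOrthogonalSum A B C) :
    WittGroup.of C = WittGroup.of A + WittGroup.of B := by
  rw [← sub_eq_zero, ← sub_sub]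
  exact (QuotientAddGroup.eq_zero_iff
    (FreeAbelianGroup.of C - FreeAbelianGroup.of A - FreeAbelianGroup.of B)).2
    (AddSubgroup.subset_closure (Or.inl ⟨A, B, C, h, rfl⟩))

theorem WittGroup.of_hyperbolicTensor {A C : SymForm K} (h : IsHyperbolicTensor A C) :
    WittGroup.of C = 0 :=
  (QuotientAddGroup.eq_zero_iff (FreeAbelianGroup.of C)).2
    (AddSubgroup.subset_closure (Or.inr ⟨A, C, h, rfl⟩))

/-- The diagonal form `∑ a_i x_i y_i` with non-zero coefficients. -/
def SymForm.diagonal {n : ℕ} (a : Fin n → K) (ha : ∀ i, a i ≠ 0) : SymForm K where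
  dim := n
  form := Matrix.toBilin' (Matrix.diagonal a)
  symm := ⟨fun x y => by simp [Matrix.toBilin'_apply', Matrix.mulVec_diagonal, dotProduct,
    mul_comm, mul_left_comm]⟩
  nondegenerate := by
    rw [Matrix.nondegenerate_toBilin'_iff]
    exact Matrix.nondegenerate_of_det_ne_zero
      (by rw [Matrix.det_diagonal]; exact Finset.prod_ne_zero_iff.2 fun i _ => ha i)

theorem SymForm.diagonal_form {n : ℕ} (a : Fin n → K) (ha : ∀ i, a i ≠ 0) (x y : Fin n → K) :
    (SymForm.diagonal a ha).form x y = ∑ i, a i * x i * y i := by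
  change Matrix.toBilin' (Matrix.diagonal a) x y = _
  rw [Matrix.toBilin'_apply']
  simp [Matrix.mulVec_diagonal, dotProduct, mul_comm, mul_left_comm]

theorem isOrthogonalSum_diagonal {k l n : ℕ} {a : Fin k → K} {b : Fin l → K} {c : Fin n → K}
    (ha : ∀ i, a i ≠ 0) (hb : ∀ i, b i ≠ 0) (hc : ∀ i, c i ≠ 0)
    (e : ((Fin k → K) × (Fin l → K)) ≃ₗ[K] (Fin n → K))
    (he : ∀ p q, ∑ i, c i * e p i * e q i =
      ∑ i, a i * p.1 i * q.1 i + ∑ i, b i * p.2 i * q.2 i) :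
    IsOrthogonalSum (SymForm.diagonal a ha) (SymForm.diagonal b hb) (SymForm.diagonal c hc) :=
  ⟨e, fun p q => (SymForm.diagonal_form c hc _ _).trans ((he p q).trans
    (congrArg₂ (· + ·) (SymForm.diagonal_form a ha _ _).symm
      (SymForm.diagonal_form b hb _ _).symm))⟩

theorem isHyperbolicTensor_diagonal {k n : ℕ} {a : Fin k → K} {c : Fin n → K}
    (ha : ∀ i, a i ≠ 0) (hc : ∀ i, c i ≠ 0)
    (e : ((Fin k → K) × (Fin k → K)) ≃ₗ[K] (Fin n → K))
    (he : ∀ p q, ∑ i, c i * e p i * e q i =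
      ∑ i, a i * p.1 i * q.2 i + ∑ i, a i * p.2 i * q.1 i) :
    IsHyperbolicTensor (SymForm.diagonal a ha) (SymForm.diagonal c hc) :=
  ⟨e, fun p q => (SymForm.diagonal_form c hc _ _).trans ((he p q).trans
    (congrArg₂ (· + ·) (SymForm.diagonal_form a ha _ _).symm
      (SymForm.diagonal_form a ha _ _).symm))⟩

open Classical in
/-- The symbol `[a] ∈ W(K)`: the class of the one-dimensional form `a x y` for `a ≠ 0` (and `0` for
`a = 0`). -/
def wittSymbol (a : K) : WittGroup K :=
  if ha : a ≠ 0 then WittGroup.of (SymForm.diagonal ![a] (by simpa using ha)) else 0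

theorem wittSymbol_of_ne {a : K} (ha : a ≠ 0) :
    wittSymbol a = WittGroup.of (SymForm.diagonal ![a] (by simpa using ha)) := by
  rw [wittSymbol, dif_pos ha]

/-- An invertible `2 × 2` matrix as an isomorphism `K × K ≃ K²`. -/
def pairEquiv (a b c d : K) (h : a * d - b * c ≠ 0) :
    ((Fin 1 → K) × (Fin 1 → K)) ≃ₗ[K] (Fin 2 → K) where
  toFun p := ![a * p.1 0 + b * p.2 0, c * p.1 0 + d * p.2 0]
  map_add' p q := by
    ext i; fin_cases i <;> simp <;> ring
  map_smul' r p := by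
    ext i; fin_cases i <;> simp <;> ring
  invFun v := (fun _ => (d * v 0 - b * v 1) / (a * d - b * c),
    fun _ => (a * v 1 - c * v 0) / (a * d - b * c))
  left_inv p := by
    ext i
    · obtain rfl : i = 0 := Subsingleton.elim _ _
      simp only [Matrix.cons_val_zero, Matrix.cons_val_one, div_eq_iff h]
      ring
    · obtain rfl : i = 0 := Subsingleton.elim _ _
      simp only [Matrix.cons_val_zero, Matrix.cons_val_one, div_eq_iff h]
      ring
  right_inv v := by
    ext i
    fin_cases i
    · change a * ((d * v 0 - b * v 1) / (a * d - b * c)) +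
        b * ((a * v 1 - c * v 0) / (a * d - b * c)) = v 0
      field_simp
      ring
    · change c * ((d * v 0 - b * v 1) / (a * d - b * c)) +
        d * ((a * v 1 - c * v 0) / (a * d - b * c)) = v 1
      rw [← mul_div_assoc, ← mul_div_assoc, ← add_div, div_eq_iff h]
      ring

theorem pairEquiv_zero {a b c d : K} (h : a * d - b * c ≠ 0) (p : (Fin 1 → K) × (Fin 1 → K)) :
    pairEquiv a b c d h p 0 = a * p.1 0 + b * p.2 0 := rfl

theorem pairEquiv_one {a b c d : K} (h : a * d - b * c ≠ 0) (p : (Fin 1 → K) × (Fin 1 → K)) :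
    pairEquiv a b c d h p 1 = c * p.1 0 + d * p.2 0 := rfl

theorem wittSymbol_mul_sq {a c : K} (ha : a ≠ 0) (hc : c ≠ 0) :
    wittSymbol (a * c ^ 2) = wittSymbol a := by
  have hz : ∀ i : Fin 0, (![] : Fin 0 → K) i ≠ 0 := fun i => i.elim0
  have h0 : WittGroup.of (SymForm.diagonal ![] hz) = 0 := by
    have h := WittGroup.of_orthogonalSum (isOrthogonalSum_diagonal hz hz hz
      { toFun := fun p => p.1
        map_add' := fun _ _ => rfl
        map_smul' := fun _ _ => rfl
        invFun := fun p => (p, p)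
        left_inv := fun p => Prod.ext rfl (Subsingleton.elim (α := Fin 0 → K) _ _)
        right_inv := fun _ => rfl } (fun p q => by simp))
    exact left_eq_add.1 h
  have hac : a * c ^ 2 ≠ 0 := mul_ne_zero ha (pow_ne_zero _ hc)
  rw [wittSymbol_of_ne hac, wittSymbol_of_ne ha]
  have h := WittGroup.of_orthogonalSum (isOrthogonalSum_diagonal
    (a := ![a * c ^ 2]) (by simpa using hac) hz (c := ![a]) (by simpa using ha)
    { toFun := fun p => c • p.1
      map_add' := fun _ _ => smul_add _ _ _
      map_smul' := fun _ _ => smul_comm _ _ _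
      invFun := fun p => (c⁻¹ • p, ![])
      left_inv := fun p => Prod.ext (inv_smul_smul₀ hc _)
        (Subsingleton.elim (α := Fin 0 → K) _ _)
      right_inv := fun p => smul_inv_smul₀ hc p } (fun p q => by
        simp only [LinearEquiv.coe_mk, LinearMap.coe_mk, AddHom.coe_mk, Fin.sum_univ_one,
          Fin.sum_univ_zero, Matrix.cons_val_zero, Pi.smul_apply, smul_eq_mul]
        ring))
  rw [h, h0, add_zero]

theorem WittGroup.of_pair {a b : K} (ha : a ≠ 0) (hb : b ≠ 0)
    (hab : ∀ i, (![a, b] : Fin 2 → K) i ≠ 0) :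
    WittGroup.of (SymForm.diagonal ![a, b] hab) = wittSymbol a + wittSymbol b := by
  rw [wittSymbol_of_ne ha, wittSymbol_of_ne hb]
  refine WittGroup.of_orthogonalSum (isOrthogonalSum_diagonal _ _ _
    (pairEquiv 1 0 0 1 (by simp)) fun p q => ?_)
  simp [Fin.sum_univ_two, pairEquiv_zero, pairEquiv_one]

theorem wittSymbol_add {a b x y c : K} (ha : a ≠ 0) (hb : b ≠ 0) (hc : c ≠ 0)
    (h : a * x ^ 2 + b * y ^ 2 = c) :
    wittSymbol a + wittSymbol b = wittSymbol c + wittSymbol (a * b * c) := by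
  have habc : a * b * c ≠ 0 := mul_ne_zero (mul_ne_zero ha hb) hc
  have hab : ∀ i, (![a, b] : Fin 2 → K) i ≠ 0 := by
    intro i; fin_cases i <;> simpa
  rw [← WittGroup.of_pair ha hb hab, wittSymbol_of_ne hc, wittSymbol_of_ne habc]
  refine WittGroup.of_orthogonalSum (isOrthogonalSum_diagonal _ _ _
    (pairEquiv x (-(b * y)) y (a * x) (by
      rw [show x * (a * x) - -(b * y) * y = c by rw [← h]; ring]
      exact hc)) fun p q => ?_)
  simp only [Fin.sum_univ_two, pairEquiv_zero, pairEquiv_one, Fin.sum_univ_one,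
    Matrix.cons_val_zero, Matrix.cons_val_one, ← h]
  ring

theorem wittSymbol_neg [NeZero (2 : K)] {a : K} (ha : a ≠ 0) :
    wittSymbol (-a) = -wittSymbol a := by
  have ha' : -a ≠ 0 := neg_ne_zero.2 ha
  have h2 : (2 : K) ≠ 0 := NeZero.ne _
  have hab : ∀ i, (![a, -a] : Fin 2 → K) i ≠ 0 := by
    intro i; fin_cases i <;> simpa
  rw [eq_neg_iff_add_eq_zero, add_comm, ← WittGroup.of_pair ha ha' hab]
  refine WittGroup.of_hyperbolicTensor (isHyperbolicTensor_diagonal (a := ![a])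
    (by simpa using ha) _ (pairEquiv 1 2⁻¹ 1 (-2⁻¹) ?_) fun p q => ?_)
  · rw [show (1 : K) * -2⁻¹ - 2⁻¹ * 1 = -(2⁻¹ + 2⁻¹) by ring, ← two_mul, mul_inv_cancel₀ h2]
    simp
  · simp only [Fin.sum_univ_two, pairEquiv_zero, pairEquiv_one, Fin.sum_univ_one,
      Matrix.cons_val_zero, Matrix.cons_val_one]
    have h3 : (2 : K)⁻¹ + 2⁻¹ = 1 := by rw [← two_mul, mul_inv_cancel₀ h2]
    linear_combination (a * (p.1 0 * q.2 0 + p.2 0 * q.1 0)) * h3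

/-! ### The signature -/

variable [LinearOrder K] [IsStrictOrderedRing K]

/-- The quadratic form `x ↦ B(x, x)`. -/
def SymForm.quadratic (A : SymForm K) : QuadraticForm K (Fin A.dim → K) :=
  LinearMap.BilinMap.toQuadraticMap A.form

theorem SymForm.sigPos_add_sigNeg (A : SymForm K) :
    sigPos A.quadratic + sigNeg A.quadratic = A.dim := by
  have h := QuadraticForm.sigPos_add_sigNeg_add_radical (Q := A.quadratic)
  have hr : A.quadratic.radical = ⊥ := by
    rw [eq_bot_iff]
    intro x hx
    rw [QuadraticMap.mem_radical_iff'] at hx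
    obtain ⟨hx0, hx⟩ := hx
    refine (Submodule.mem_bot K).2 (A.nondegenerate.1 x fun y => ?_)
    have := hx y
    simp only [SymForm.quadratic, LinearMap.BilinMap.toQuadraticMap_apply, map_add,
      LinearMap.add_apply] at this hx0
    rw [hx0, A.symm.eq y x] at this
    linarith
  rw [hr, finrank_bot, Module.finrank_fin_fun] at h
  simpa using h

theorem sigPos_prod_ge {M N : Type*} [AddCommGroup M] [AddCommGroup N] [Module K M] [Module K N]
    [FiniteDimensional K M] [FiniteDimensional K N] (P : QuadraticForm K M)
    (Q : QuadraticForm K N) : sigPos P + sigPos Q ≤ sigPos (P.prod Q) := by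
  obtain ⟨V, hV, hV'⟩ := exists_finrank_eq_sigPos_and_posDef P
  obtain ⟨W, hW, hW'⟩ := exists_finrank_eq_sigPos_and_posDef Q
  have hinj : Function.Injective (V.subtype.prodMap W.subtype) :=
    Function.Injective.prodMap V.injective_subtype W.injective_subtype
  have hP : ∀ x : V, 0 ≤ P x := fun x => by
    by_cases h0 : x = 0
    · simp [h0]
    · exact (hV' x h0).le
  have hQ : ∀ y : W, 0 ≤ Q y := fun y => by
    by_cases h0 : y = 0
    · simp [h0]
    · exact (hW' y h0).le
  have h : ((P.prod Q).restrict (LinearMap.range (V.subtype.prodMap W.subtype))).PosDef := by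
    rintro ⟨_, ⟨x, y⟩, rfl⟩ hxy
    change 0 < P x + Q y
    by_cases h0 : x = 0
    · have h1 : y ≠ 0 := by
        rintro rfl
        apply hxy
        ext <;> simp [h0]
      exact add_pos_of_nonneg_of_pos (hP x) (hW' y h1)
    · exact add_pos_of_pos_of_nonneg (hV' x h0) (hQ y)
  have h1 := le_sigPos_of_posDef _ h
  rwa [LinearMap.finrank_range_of_inj hinj, Module.finrank_prod, hV, hW] at h1

theorem SymForm.sig_orthogonalSum {A B C : SymForm K} (h : IsOrthogonalSum A B C) :
    sigPos C.quadratic = sigPos A.quadratic + sigPos B.quadratic ∧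
      sigNeg C.quadratic = sigNeg A.quadratic + sigNeg B.quadratic := by
  obtain ⟨e, he⟩ := h
  have h1 : QuadraticMap.Equivalent (A.quadratic.prod B.quadratic) C.quadratic :=
    ⟨⟨e, fun p => he p p⟩⟩
  have h2 : QuadraticMap.Equivalent ((-A.quadratic).prod (-B.quadratic)) (-C.quadratic) :=
    ⟨⟨e, fun p => by
      have := he p p
      change -(C.form (e p) (e p)) = -(A.form p.1 p.1) + -(B.form p.2 p.2)
      rw [this]; ring⟩⟩
  have hp := sigPos_prod_ge A.quadratic B.quadratic
  have hn := sigPos_prod_ge (-A.quadratic) (-B.quadratic)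
  rw [h1.sigPos_eq] at hp
  rw [h2.sigPos_eq, sigPos_neg, sigPos_neg, sigPos_neg] at hn
  have hA := A.sigPos_add_sigNeg
  have hB := B.sigPos_add_sigNeg
  have hC := C.sigPos_add_sigNeg
  have hd := e.finrank_eq
  rw [Module.finrank_prod, Module.finrank_fin_fun, Module.finrank_fin_fun,
    Module.finrank_fin_fun] at hd
  omega

variable (K) in
/-- The signature `σ : W(K) → ℤ`, sending a form to the dimension of a maximal positive definite
subspace minus the dimension of a maximal negative definite one. -/
def signature : WittGroup K →+ ℤ :=
  QuotientAddGroup.lift (wittRelations K)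
    (FreeAbelianGroup.lift fun A : SymForm K =>
      (sigPos A.quadratic : ℤ) - (sigNeg A.quadratic : ℤ)) (by
    rw [wittRelations, AddSubgroup.closure_le]
    rintro _ (⟨A, B, C, h, rfl⟩ | ⟨A, C, ⟨e, he⟩, rfl⟩)
    · obtain ⟨h1, h2⟩ := SymForm.sig_orthogonalSum h
      simp only [SetLike.mem_coe, AddMonoidHom.mem_ker, map_sub, FreeAbelianGroup.lift_apply_of,
        h1, h2]
      push_cast
      ring
    · have h : QuadraticMap.Equivalent C.quadratic (-C.quadratic) := by
        refine ⟨⟨e.symm.trans (((LinearEquiv.refl K _).prodCongr (LinearEquiv.neg K)).trans e),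
          fun x => ?_⟩⟩
        obtain ⟨p, rfl⟩ := e.surjective x
        change -(C.form _ _) = C.form (e p) (e p)
        simp [he]
        ring
      simp only [SetLike.mem_coe, AddMonoidHom.mem_ker, FreeAbelianGroup.lift_apply_of]
      rw [h.sigPos_eq, sigPos_neg, sub_self])

end Witt

/-! ### The groups -/

section Groups

variable (K : Type u) [Field K] [LinearOrder K] [IsStrictOrderedRing K]

/-- The scalar matrices `λ I`, `λ ∈ K^×`, inside `GL_+(2, K)`. -/
def scalarMatrices : Subgroup (Matrix.GLPos (Fin 2) K) :=
  (Matrix.GeneralLinearGroup.scalar (Fin 2) (R := K)).range.subgroupOf (Matrix.GLPos (Fin 2) K)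

/-- The scalar matrices `λ I` with `λ > 0`, inside `GL_+(2, K)`. -/
def posScalarMatrices : Subgroup (Matrix.GLPos (Fin 2) K) :=
  ((Units.posSubgroup K).map (Matrix.GeneralLinearGroup.scalar (Fin 2) (R := K))).subgroupOf
    (Matrix.GLPos (Fin 2) K)

variable {K}

theorem mem_scalarMatrices {g : Matrix.GLPos (Fin 2) K} :
    g ∈ scalarMatrices K ↔ ∃ c : Kˣ, Matrix.GeneralLinearGroup.scalar (Fin 2) c = g := by
  rw [scalarMatrices, Subgroup.mem_subgroupOf, MonoidHom.mem_range]

theorem mem_posScalarMatrices {g : Matrix.GLPos (Fin 2) K} :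
    g ∈ posScalarMatrices K ↔
      ∃ c : Kˣ, 0 < (c : K) ∧ Matrix.GeneralLinearGroup.scalar (Fin 2) c = g := by
  rw [posScalarMatrices, Subgroup.mem_subgroupOf, Subgroup.mem_map]
  rfl

theorem scalar_conj (c : Kˣ) (n g : Matrix.GLPos (Fin 2) K)
    (h : Matrix.GeneralLinearGroup.scalar (Fin 2) c = (n : GL (Fin 2) K)) : g * n * g⁻¹ = n := by
  have h1 : (n : GL (Fin 2) K) ∈ Subgroup.center (GL (Fin 2) K) := by
    rw [Matrix.GeneralLinearGroup.center_eq_range_scalar]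
    exact ⟨c, h⟩
  refine Subtype.ext ?_
  have h2 := Subgroup.mem_center_iff.1 h1 g
  change (g : GL (Fin 2) K) * n * (g : GL (Fin 2) K)⁻¹ = n
  rw [h2, mul_inv_cancel_right]

instance : (scalarMatrices K).Normal where
  conj_mem n hn g := by
    obtain ⟨c, hc⟩ := mem_scalarMatrices.1 hn
    rwa [scalar_conj c n g hc]

instance : (posScalarMatrices K).Normal where
  conj_mem n hn g := by
    obtain ⟨c, _, hc⟩ := mem_posScalarMatrices.1 hn
    rwa [scalar_conj c n g hc]

variable (K)

/-- `PGL_+(2, K) = GL_+(2, K) / {λ I}`. -/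
abbrev PGLPos : Type u := Matrix.GLPos (Fin 2) K ⧸ scalarMatrices K

/-- `P_+GL_+(2, K) = GL_+(2, K) / {λ I : λ > 0}`. -/
abbrev PposGLPos : Type u := Matrix.GLPos (Fin 2) K ⧸ posScalarMatrices K

/-- The natural map `SL(2, K) → PSL(2, K)`. -/
def slToPSL : SL(2, K) →* PSL(2, K) := QuotientGroup.mk' _

/-- The natural map `SL(2, K) → GL_+(2, K) → P_+GL_+(2, K)`. -/
def slToPposGLPos : SL(2, K) →* PposGLPos K :=
  (QuotientGroup.mk' (posScalarMatrices K)).comp Matrix.SpecialLinearGroup.toGLPos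

/-- The inclusion `PSL(2, K) → PGL_+(2, K)` induced by `SL(2, K) ⊆ GL_+(2, K)`. -/
def pslToPGLPos : PSL(2, K) →* PGLPos K :=
  QuotientGroup.lift _
    ((QuotientGroup.mk' (scalarMatrices K)).comp Matrix.SpecialLinearGroup.toGLPos) (by
    intro g hg
    rw [MonoidHom.mem_ker, MonoidHom.comp_apply, QuotientGroup.mk'_apply,
      QuotientGroup.eq_one_iff, mem_scalarMatrices]
    have h := (Matrix.SpecialLinearGroup.toGL_mem_center_iff g).2 hg
    rw [Matrix.GeneralLinearGroup.center_eq_range_scalar] at h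
    exact h)

/-- The projective line `P¹(K)`. -/
abbrev ProjLine : Type u := ℙ K (Fin 2 → K)

/-- The positive projective line `P¹_+(K) = (K² ∖ {0}) / K_+`. -/
abbrev PosProjLine : Type u := Module.Ray K (Fin 2 → K)

variable {K}

theorem smul_projLine_eq (g : Matrix.GLPos (Fin 2) K) (hg : g ∈ scalarMatrices K)
    (p : ProjLine K) : g • p = p := by
  obtain ⟨c, hc⟩ := mem_scalarMatrices.1 hg
  induction p using Projectivization.ind with | _ v hv =>
  change (g : GL (Fin 2) K) • Projectivization.mk K v hv = _
  rw [Projectivization.smul_mk, Projectivization.mk_eq_mk_iff]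
  refine ⟨c, ?_⟩
  change _ = (g : GL (Fin 2) K) • v
  rw [← hc]
  ext i
  simp [Units.smul_def]

theorem smul_posProjLine_eq (g : Matrix.GLPos (Fin 2) K) (hg : g ∈ posScalarMatrices K)
    (p : PosProjLine K) : g • p = p := by
  obtain ⟨c, hc0, hc⟩ := mem_posScalarMatrices.1 hg
  induction p using Module.Ray.ind with | _ v hv =>
  have e : (g : GL (Fin 2) K) • v = (c : K) • v := by
    rw [← hc]
    ext i
    simp [Units.smul_def]
  change (g : GL (Fin 2) K) • rayOfNeZero K v hv = _
  rw [smul_rayOfNeZero, ray_eq_iff, e]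
  exact SameRay.sameRay_pos_smul_left v hc0

/-- The action of `PGL_+(2, K)` on the projective line. -/
instance : MulAction (PGLPos K) (ProjLine K) :=
  MulAction.compHom (ProjLine K) (QuotientGroup.lift (scalarMatrices K)
    (MulAction.toPermHom (Matrix.GLPos (Fin 2) K) (ProjLine K))
    fun g hg => Equiv.ext fun p => smul_projLine_eq g hg p)

/-- The action of `P_+GL_+(2, K)` on the positive projective line. -/
instance : MulAction (PposGLPos K) (PosProjLine K) :=
  MulAction.compHom (PosProjLine K) (QuotientGroup.lift (posScalarMatrices K)
    (MulAction.toPermHom (Matrix.GLPos (Fin 2) K) (PosProjLine K))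
    fun g hg => Equiv.ext fun p => smul_posProjLine_eq g hg p)

theorem PGLPos.mk_smul (g : Matrix.GLPos (Fin 2) K) (p : ProjLine K) :
    (QuotientGroup.mk g : PGLPos K) • p = g • p := rfl

theorem PposGLPos.mk_smul (g : Matrix.GLPos (Fin 2) K) (p : PosProjLine K) :
    (QuotientGroup.mk g : PposGLPos K) • p = g • p := rfl

end Groups

/-! ### The configuration complexes -/

section Configurations

variable {K : Type u} [Field K]

/-- The determinant of the matrix with columns `u` and `v`. -/
def det2 (u v : Fin 2 → K) : K := Matrix.det !![u 0, v 0; u 1, v 1]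

theorem det2_eq (u v : Fin 2 → K) : det2 u v = u 0 * v 1 - v 0 * u 1 := Matrix.det_fin_two_of _ _ _ _

theorem det2_swap (u v : Fin 2 → K) : det2 v u = -det2 u v := by
  rw [det2_eq, det2_eq]; ring

theorem det2_smul_smul (a b : K) (u v : Fin 2 → K) :
    det2 (a • u) (b • v) = a * b * det2 u v := by
  simp only [det2_eq, Pi.smul_apply, smul_eq_mul]; ring

theorem det2_mulVec (A : Matrix (Fin 2) (Fin 2) K) (u v : Fin 2 → K) :
    det2 (A.mulVec u) (A.mulVec v) = A.det * det2 u v := by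
  simp only [det2_eq, Matrix.det_fin_two, Matrix.mulVec, dotProduct, Fin.sum_univ_two]; ring

theorem det2_plucker (a b c d : Fin 2 → K) :
    det2 a b * det2 c d - det2 a c * det2 b d + det2 a d * det2 b c = 0 := by
  simp only [det2_eq]; ring

/-- The coordinates of `w` in the basis `(u, v)`. -/
def coord (u v w : Fin 2 → K) : Fin 2 → K := ![det2 w v / det2 u v, det2 u w / det2 u v]

theorem coord_spec {u v : Fin 2 → K} (h : det2 u v ≠ 0) (w : Fin 2 → K) :
    w = coord u v w 0 • u + coord u v w 1 • v := by
  have h' := h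
  rw [det2_eq] at h'
  funext i
  simp only [coord, Matrix.cons_val_zero, Matrix.cons_val_one, Pi.add_apply, Pi.smul_apply,
    smul_eq_mul, det2_eq]
  rw [div_mul_eq_mul_div, div_mul_eq_mul_div, ← add_div, eq_div_iff h']
  fin_cases i <;> simp <;> ring

theorem linearIndependent_iff_det2 (u v : Fin 2 → K) :
    LinearIndependent K ![u, v] ↔ det2 u v ≠ 0 := by
  rw [show det2 u v = Matrix.det (Matrix.of ![u, v]) by
    rw [Matrix.det_fin_two, det2_eq]; simp; ring, ← isUnit_iff_ne_zero,
    ← Matrix.isUnit_iff_isUnit_det, ← Matrix.linearIndependent_rows_iff_isUnit]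
  rfl

theorem exists_det2_ne_zero [Infinite K] (S : Finset (Fin 2 → K)) (hS : ∀ v ∈ S, v ≠ 0) :
    ∃ w : Fin 2 → K, w ≠ 0 ∧ ∀ v ∈ S, det2 w v ≠ 0 := by
  classical
  obtain ⟨c, hc⟩ := Infinite.exists_notMem_finset (S.image fun v => v 1 / v 0)
  refine ⟨![1, c], fun h => one_ne_zero (congrFun h 0), fun v hv h => ?_⟩
  rw [det2_eq] at h
  simp only [Matrix.cons_val_zero, Matrix.cons_val_one, one_mul] at h
  by_cases h0 : v 0 = 0
  · refine hS v hv (funext fun i => ?_)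
    fin_cases i
    · exact h0
    · simpa [h0] using h
  · refine hc (Finset.mem_image.2 ⟨v, hv, ?_⟩)
    rw [div_eq_iff h0]
    linear_combination h

theorem det2_rep_ne_zero {p q : ProjLine K} (h : p ≠ q) : det2 p.rep q.rep ≠ 0 := by
  rw [← linearIndependent_iff_det2]
  exact Projectivization.linearIndependent_pair_iff_ne.2 h

variable (K) in
/-- The complex `X` of the projective line: a tuple of points is generic, i.e. spans a simplex, if
and only if its entries are pairwise distinct, so `X` is the full simplex on `P¹(K)`. -/
def projComplex : AbstractSimplicialComplex (ProjLine K) := ⊤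

theorem projComplex_isInvariant (G : Type u) [Group G] [MulAction G (ProjLine K)] :
    IsInvariant G (projComplex K) :=
  fun _ _ hs => Finset.Nonempty.map hs

theorem projComplex_isAcyclic [Infinite K] : IsAcyclic (projComplex K) := by
  classical
  refine HasStarProperty.isAcyclic fun F => ?_
  obtain ⟨w, hw, h⟩ := exists_det2_ne_zero (F.image fun p => p.rep) (by
    intro v hv
    obtain ⟨p, _, rfl⟩ := Finset.mem_image.1 hv
    exact p.rep_nonzero)
  have hF : Projectivization.mk K w hw ∉ F := by
    intro hmem
    have h1 := h _ (Finset.mem_image_of_mem _ hmem)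
    obtain ⟨a, ha⟩ := Projectivization.exists_smul_eq_mk_rep K w hw
    rw [← ha, det2_eq] at h1
    apply h1
    simp only [Units.smul_def, Pi.smul_apply, smul_eq_mul]
    ring
  exact ⟨_, hF, fun s _ hs => ⟨fun hv => hF (hs hv), Finset.cons_nonempty _⟩⟩

theorem proj_smul_rep (g : GL (Fin 2) K) (p : ProjLine K) :
    ∃ c : K, c ≠ 0 ∧ (g • p).rep = c • (g : Matrix (Fin 2) (Fin 2) K).mulVec p.rep := by
  have h : g • p = Projectivization.mk K (g • p.rep)
      ((smul_ne_zero_iff_ne _).2 p.rep_nonzero) := by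
    conv_lhs => rw [← Projectivization.mk_rep p]
    rfl
  rw [h]
  obtain ⟨a, ha⟩ := Projectivization.exists_smul_eq_mk_rep K (g • p.rep)
    ((smul_ne_zero_iff_ne g).2 p.rep_nonzero)
  exact ⟨a, a.ne_zero, ha.symm⟩

variable [LinearOrder K] [IsStrictOrderedRing K]

theorem someVector_spec (v : Fin 2 → K) (hv : v ≠ 0) :
    ∃ c : K, 0 < c ∧ (rayOfNeZero K v hv).someVector = c • v := by
  have h := Module.Ray.someVector_ray (rayOfNeZero K v hv)
  rw [ray_eq_iff] at h
  obtain ⟨a, b, ha, hb, hab⟩ := h.exists_pos (Module.Ray.someVector_ne_zero _) hv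
  refine ⟨a⁻¹ * b, by positivity, ?_⟩
  rw [mul_smul, ← hab, inv_smul_smul₀ ha.ne']

theorem ray_smul_someVector (g : Matrix.GLPos (Fin 2) K) (p : PosProjLine K) :
    ∃ c : K, 0 < c ∧ (g • p).someVector =
      c • ((g : GL (Fin 2) K) : Matrix (Fin 2) (Fin 2) K).mulVec p.someVector := by
  have h : g • p = rayOfNeZero K ((g : GL (Fin 2) K) • p.someVector)
      ((smul_ne_zero_iff_ne _).2 p.someVector_ne_zero) := by
    conv_lhs => rw [← Module.Ray.someVector_ray p]
    rfl
  rw [h]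
  exact someVector_spec _ _

variable (K) in
/-- The complex `X_+` of the positive projective line: a tuple of points is generic, i.e. spans a
simplex, if and only if its entries are represented by pairwise linearly independent vectors. -/
def rayComplex : AbstractSimplicialComplex (PosProjLine K) where
  faces := {s | s.Nonempty ∧
    ∀ p ∈ s, ∀ q ∈ s, p ≠ q → LinearIndependent K ![p.someVector, q.someVector]}
  isRelLowerSet_faces := fun _ hs => ⟨hs.1, fun _ ht hne =>
    ⟨hne, fun p hp q hq => hs.2 p (ht hp) q (ht hq)⟩⟩
  singleton_mem p := ⟨Finset.singleton_nonempty p, fun q hq r hr hqr => by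
    rw [Finset.mem_singleton] at hq hr
    exact (hqr (hq.trans hr.symm)).elim⟩

theorem rayComplex_isInvariant : IsInvariant (PposGLPos K) (rayComplex K) := by
  intro g s hs
  induction g using QuotientGroup.induction_on with | H g =>
  refine ⟨Finset.Nonempty.map hs.1, ?_⟩
  intro p hp q hq hpq
  obtain ⟨p, hpm, rfl⟩ := Finset.mem_map.1 hp
  obtain ⟨q, hqm, rfl⟩ := Finset.mem_map.1 hq
  have h := hs.2 p hpm q hqm (fun h => hpq (by rw [h]))
  change LinearIndependent K ![(g • p).someVector, (g • q).someVector]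
  rw [linearIndependent_iff_det2] at h ⊢
  obtain ⟨c, hc, hc'⟩ := ray_smul_someVector g p
  obtain ⟨d, hd, hd'⟩ := ray_smul_someVector g q
  rw [hc', hd', det2_smul_smul, det2_mulVec]
  exact mul_ne_zero (mul_ne_zero hc.ne' hd.ne')
    (mul_ne_zero (Matrix.GLPos.det_ne_zero g) h)

theorem rayComplex_isAcyclic : IsAcyclic (rayComplex K) := by
  classical
  refine HasStarProperty.isAcyclic fun F => ?_
  obtain ⟨w, hw, h⟩ := exists_det2_ne_zero (F.image fun p => p.someVector) (by
    intro v hv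
    obtain ⟨p, _, rfl⟩ := Finset.mem_image.1 hv
    exact p.someVector_ne_zero)
  obtain ⟨c, hc, hc'⟩ := someVector_spec w hw
  have hdet : ∀ p ∈ F, det2 (rayOfNeZero K w hw).someVector p.someVector ≠ 0 := by
    intro p hp
    have h1 := h _ (Finset.mem_image_of_mem _ hp)
    rw [hc', ← one_smul K p.someVector, det2_smul_smul]
    exact mul_ne_zero (by simpa using hc.ne') h1
  have hF : rayOfNeZero K w hw ∉ F := by
    intro hmem
    refine hdet _ hmem ?_
    rw [det2_eq]
    ring
  refine ⟨_, hF, fun s hs hsF => ⟨fun hv => hF (hsF hv), Finset.cons_nonempty _, ?_⟩⟩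
  intro p hp q hq hpq
  rw [linearIndependent_iff_det2]
  rcases Finset.mem_cons.1 hp with rfl | hp
  · rcases Finset.mem_cons.1 hq with rfl | hq
    · exact (hpq rfl).elim
    · exact hdet q (hsF hq)
  · rcases Finset.mem_cons.1 hq with rfl | hq
    · rw [det2_swap]
      exact neg_ne_zero.2 (hdet p (hsF hp))
    · rw [← linearIndependent_iff_det2]
      exact hs.2 p hp q hq hpq

theorem det2_someVector_ne_zero {n : ℕ} (σ : OrderedSimplex (rayComplex K) n)
    {i j : Fin (n + 1)} (h : i ≠ j) :
    det2 (σ.vertex i).someVector (σ.vertex j).someVector ≠ 0 := by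
  rw [← linearIndependent_iff_det2]
  exact σ.2.2 _ (Finset.mem_map_of_mem _ (Finset.mem_univ i)) _
    (Finset.mem_map_of_mem _ (Finset.mem_univ j)) fun e => h (σ.1.injective e)

end Configurations

/-! ### Symbols of triangles -/

theorem alternating_of_swap {V : Type u} {X : AbstractSimplicialComplex V} {d : ℕ} {A : Type*}
    [AddCommGroup A] (f : OrderedSimplex X d → A)
    (h : ∀ σ (i : Fin d), f (σ.perm (Equiv.swap i.castSucc i.succ)) = -f σ)
    (σ : OrderedSimplex X d) (t : Equiv.Perm (Fin (d + 1))) :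
    f (σ.perm t) = (Equiv.Perm.sign t : ℤ) • f σ := by
  have ht : t ∈ Submonoid.closure
      (Set.range fun i : Fin d => Equiv.swap i.castSucc i.succ) := by
    rw [Equiv.Perm.mclosure_swap_castSucc_succ]
    exact Submonoid.mem_top t
  induction ht using Submonoid.closure_induction generalizing σ with
  | mem t ht =>
    obtain ⟨i, rfl⟩ := ht
    rw [h, Equiv.Perm.sign_swap (Fin.castSucc_lt_succ (i := i)).ne]
    simp
  | one =>
    rw [Equiv.Perm.sign_one, Units.val_one, one_smul]
    rfl
  | mul s t _ _ hs ht =>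
    have e : σ.perm (s * t) = (σ.perm s).perm t := rfl
    rw [e, ht, hs, smul_smul, Equiv.Perm.sign_mul, Units.val_mul, mul_comm]

section Symbols

variable {K : Type u} [Field K]

/-- `det(u, v) det(v, w) det(w, u)`. -/
def triDet (u v w : Fin 2 → K) : K := det2 u v * det2 v w * det2 w u

theorem triDet_smul (a b c : K) (u v w : Fin 2 → K) :
    triDet (a • u) (b • v) (c • w) = triDet u v w * (a * b * c) ^ 2 := by
  simp only [triDet, det2_smul_smul]; ring

theorem triDet_mulVec (A : Matrix (Fin 2) (Fin 2) K) (u v w : Fin 2 → K) :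
    triDet (A.mulVec u) (A.mulVec v) (A.mulVec w) = A.det ^ 3 * triDet u v w := by
  simp only [triDet, det2_mulVec]; ring

theorem triDet_swap_left (u v w : Fin 2 → K) : triDet v u w = -triDet u v w := by
  simp only [triDet, det2_eq]; ring

theorem triDet_swap_right (u v w : Fin 2 → K) : triDet u w v = -triDet u v w := by
  simp only [triDet, det2_eq]; ring

theorem triDet_ne_zero {u v w : Fin 2 → K} (h1 : det2 u v ≠ 0) (h2 : det2 v w ≠ 0)
    (h3 : det2 u w ≠ 0) : triDet u v w ≠ 0 := by
  rw [triDet, det2_swap u w]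
  exact mul_ne_zero (mul_ne_zero h1 h2) (neg_ne_zero.2 h3)

/-- `det(u, v) det(v, w) det(w, u)` for representatives `u, v, w` of the vertices of a triangle in
the projective line; it is well-defined up to squares. -/
def OrderedSimplex.triDet (σ : OrderedSimplex (projComplex K) 2) : K :=
  FlatEuler.triDet (σ.vertex 0).rep (σ.vertex 1).rep (σ.vertex 2).rep

theorem det2_vertex_rep_ne_zero {n : ℕ} (σ : OrderedSimplex (projComplex K) n)
    {i j : Fin (n + 1)} (h : i ≠ j) : det2 (σ.vertex i).rep (σ.vertex j).rep ≠ 0 :=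
  det2_rep_ne_zero fun e => h (σ.1.injective e)

theorem OrderedSimplex.triDet_ne_zero (σ : OrderedSimplex (projComplex K) 2) : σ.triDet ≠ 0 :=
  FlatEuler.triDet_ne_zero (det2_vertex_rep_ne_zero σ (by decide))
    (det2_vertex_rep_ne_zero σ (by decide)) (det2_vertex_rep_ne_zero σ (by decide))

theorem triDet_perm (σ : OrderedSimplex (projComplex K) 2) (i : Fin 2) :
    (σ.perm (Equiv.swap i.castSucc i.succ)).triDet = -σ.triDet := by
  fin_cases i
  · exact triDet_swap_left (σ.vertex 0).rep (σ.vertex 1).rep (σ.vertex 2).rep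
  · exact triDet_swap_right (σ.vertex 0).rep (σ.vertex 1).rep (σ.vertex 2).rep

theorem triDet_boundary {A : Type*} [AddCommGroup A] (F : K → A)
    (hsq : ∀ a c : K, a ≠ 0 → c ≠ 0 → F (a * c ^ 2) = F a)
    (hadd : ∀ a b x y c : K, a ≠ 0 → b ≠ 0 → c ≠ 0 → a * x ^ 2 + b * y ^ 2 = c →
      F a + F b = F c + F (a * b * c))
    (σ : OrderedSimplex (projComplex K) 3) :
    ∑ i : Fin 4, (-1 : ℤ) ^ (i : ℕ) • F (σ.face i).triDet = 0 := by
  set p := (σ.vertex 0).rep with hp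
  set q := (σ.vertex 1).rep with hq
  set r := (σ.vertex 2).rep with hr
  set s := (σ.vertex 3).rep with hs
  have e0 : (σ.face 0).triDet = triDet q r s := rfl
  have e1 : (σ.face 1).triDet = triDet p r s := rfl
  have e2 : (σ.face 2).triDet = triDet p q s := rfl
  have e3 : (σ.face 3).triDet = triDet p q r := rfl
  have h02 : det2 p s ≠ 0 := det2_vertex_rep_ne_zero σ (i := 0) (j := 3) (by decide)
  have h13 : det2 q s ≠ 0 := det2_vertex_rep_ne_zero σ (i := 1) (j := 3) (by decide)
  have h23 : det2 r s ≠ 0 := det2_vertex_rep_ne_zero σ (i := 2) (j := 3) (by decide)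
  have key := hadd (σ.face 0).triDet (σ.face 2).triDet (det2 p s / det2 q s)
    (det2 r s / det2 q s) (σ.face 1).triDet (OrderedSimplex.triDet_ne_zero _)
    (OrderedSimplex.triDet_ne_zero _) (OrderedSimplex.triDet_ne_zero _) (by
      rw [e0, e1, e2, div_pow, div_pow, mul_div_assoc', mul_div_assoc', ← add_div,
        div_eq_iff (pow_ne_zero _ h13)]
      simp only [triDet, det2_eq]; ring)
  have hm : (σ.face 0).triDet * (σ.face 2).triDet * (σ.face 1).triDet =
      (σ.face 3).triDet * (det2 r s * det2 q s * det2 p s) ^ 2 := by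
    rw [e0, e1, e2, e3]
    simp only [triDet, det2_eq]; ring
  rw [hm, hsq _ _ (OrderedSimplex.triDet_ne_zero _)
    (mul_ne_zero (mul_ne_zero h23 h13) h02)] at key
  rw [Fin.sum_univ_four]
  simp only [Fin.val_zero, Fin.val_one, pow_zero, pow_one, one_smul, neg_smul,
    show ((2 : Fin 4) : ℕ) = 2 from rfl, show ((3 : Fin 4) : ℕ) = 3 from rfl,
    show (-1 : ℤ) ^ 2 = 1 by norm_num, show (-1 : ℤ) ^ 3 = -1 by norm_num]
  rw [← sub_eq_zero.2 key]
  abel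

theorem triDet_smul_vertices (g : GL (Fin 2) K) (p q r : ProjLine K) :
    ∃ c : K, c ≠ 0 ∧ triDet (g • p).rep (g • q).rep (g • r).rep =
      (g : Matrix (Fin 2) (Fin 2) K).det * triDet p.rep q.rep r.rep * c ^ 2 := by
  obtain ⟨a, ha, ha'⟩ := proj_smul_rep g p
  obtain ⟨b, hb, hb'⟩ := proj_smul_rep g q
  obtain ⟨c, hc, hc'⟩ := proj_smul_rep g r
  refine ⟨(g : Matrix (Fin 2) (Fin 2) K).det * (a * b * c), mul_ne_zero ?_
    (mul_ne_zero (mul_ne_zero ha hb) hc), ?_⟩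
  · exact (Matrix.isUnits_det_units g).ne_zero
  · rw [ha', hb', hc', triDet_smul, triDet_mulVec]; ring

/-! ### The Witt class -/

/-- The symbol `([u], [v], [w]) ↦ [det(u, v) det(v, w) det(w, u)]` in `W(K)`. -/
def wittTriangle (σ : OrderedSimplex (projComplex K) 2) : WittGroup K := wittSymbol σ.triDet

theorem wittTriangle_act (g : PSL(2, K)) (σ : OrderedSimplex (projComplex K) 2) :
    wittTriangle (σ.act (projComplex_isInvariant PSL(2, K)) g) = wittTriangle σ := by
  induction g using QuotientGroup.induction_on with | H g =>
  obtain ⟨c, hc, h⟩ := triDet_smul_vertices (g : GL (Fin 2) K) (σ.vertex 0) (σ.vertex 1)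
    (σ.vertex 2)
  have e : (σ.act (projComplex_isInvariant PSL(2, K)) (QuotientGroup.mk g)).triDet =
      σ.triDet * c ^ 2 := by
    have h1 : ((g : GL (Fin 2) K) : Matrix (Fin 2) (Fin 2) K).det = 1 := g.2
    rw [h1, one_mul] at h
    exact h
  rw [wittTriangle, wittTriangle, e, wittSymbol_mul_sq σ.triDet_ne_zero hc]

variable (K) in
/-- The homomorphism `U_2(X) → W(K)`, `([u], [v], [w]) ↦ [det(u, v) det(v, w) det(w, u)]`, on the
coinvariants of `PSL(2, K)`. -/
def wittCoeff [NeZero (2 : K)] :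
    Coeff (projComplex_isInvariant (K := K) PSL(2, K)) 2 →+ WittGroup K :=
  Coeff.lift _ wittTriangle
    (alternating_of_swap _ fun σ i => by
      rw [wittTriangle, triDet_perm, wittSymbol_neg σ.triDet_ne_zero, wittTriangle])
    wittTriangle_act
    (triDet_boundary wittSymbol (fun _ _ => wittSymbol_mul_sq)
      fun _ _ _ _ _ => wittSymbol_add)

variable (K) in
/-- The Witt class `w ∈ H²(PSL(2, K), W(K))`. -/
def wittClass [Infinite K] [NeZero (2 : K)] : H2 PSL(2, K) (WittGroup K) :=
  H2.push (wittCoeff K)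
    (tautologicalClass (projComplex_isInvariant PSL(2, K)) projComplex_isAcyclic)

/-! ### The Euler class -/

variable [LinearOrder K]

/-- The sign of an element of `K`, as an integer. -/
def sgn (a : K) : ℤ := (SignType.sign a : ℤ)

theorem sgn_pos {a : K} (h : 0 < a) : sgn a = 1 := by simp [sgn, h]

theorem sgn_neg {a : K} (h : a < 0) : sgn a = -1 := by simp [sgn, h]

/-- `±1` if the three arguments have the common sign `±1`, and `0` otherwise. -/
def commonSign (x y z : K) : ℤ :=
  if 0 < x ∧ 0 < y ∧ 0 < z then 1 else if x < 0 ∧ y < 0 ∧ z < 0 then -1 else 0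

theorem commonSign_cycle (x y z : K) : commonSign x y z = commonSign y z x := by
  simp only [commonSign]
  split_ifs <;> first | rfl | (exfalso; grind)

variable [IsStrictOrderedRing K]

theorem sgn_mul (a b : K) : sgn (a * b) = sgn a * sgn b := by
  simp [sgn, sign_mul]

theorem sgn_mul_sq (a c : K) (_ : a ≠ 0) (hc : c ≠ 0) : sgn (a * c ^ 2) = sgn a := by
  rw [sgn_mul, sgn_pos (by positivity : 0 < c ^ 2), mul_one]

theorem sgn_add (a b x y c : K) (ha : a ≠ 0) (hb : b ≠ 0) (hc : c ≠ 0)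
    (h : a * x ^ 2 + b * y ^ 2 = c) : sgn a + sgn b = sgn c + sgn (a * b * c) := by
  rw [sgn_mul, sgn_mul]
  rcases lt_or_gt_of_ne ha with ha | ha <;> rcases lt_or_gt_of_ne hb with hb | hb <;>
    rcases lt_or_gt_of_ne hc with hc | hc <;>
    simp only [sgn_pos, sgn_neg, ha, hb, hc] <;> try norm_num
  · nlinarith [mul_nonneg (neg_nonneg.2 ha.le) (sq_nonneg x),
      mul_nonneg (neg_nonneg.2 hb.le) (sq_nonneg y)]
  · nlinarith [mul_nonneg (le_of_lt ha) (sq_nonneg x), mul_nonneg (le_of_lt hb) (sq_nonneg y)]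

/-- The symbol of a triangle `(v_0, v_1, v_2)` in the projective line: the sign of
`det(v_0, v_1) α_0 α_1`, where `v_2 = α_0 v_0 + α_1 v_1`. -/
def eulerTriangle (σ : OrderedSimplex (projComplex K) 2) : ℤ :=
  let v : Fin 3 → Fin 2 → K := fun i => (σ.vertex i).rep
  let α : Fin 2 → K := coord (v 0) (v 1) (v 2)
  sgn (det2 (v 0) (v 1) * α 0 * α 1)

theorem eulerTriangle_eq (σ : OrderedSimplex (projComplex K) 2) :
    eulerTriangle σ = sgn σ.triDet := by
  have h : det2 (σ.vertex 0).rep (σ.vertex 1).rep ≠ 0 := det2_vertex_rep_ne_zero σ (by decide)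
  rw [← sgn_mul_sq σ.triDet _ σ.triDet_ne_zero (inv_ne_zero h)]
  refine congrArg sgn ?_
  simp only [OrderedSimplex.triDet, triDet, coord, Matrix.cons_val_zero, Matrix.cons_val_one]
  rw [det2_swap (σ.vertex 1).rep (σ.vertex 2).rep, det2_swap (σ.vertex 0).rep (σ.vertex 2).rep]
  field_simp

theorem eulerTriangle_act (g : PGLPos K) (σ : OrderedSimplex (projComplex K) 2) :
    eulerTriangle (σ.act (projComplex_isInvariant (PGLPos K)) g) = eulerTriangle σ := by
  rw [eulerTriangle_eq, eulerTriangle_eq]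
  induction g using QuotientGroup.induction_on with | H g =>
  obtain ⟨c, hc, h⟩ := triDet_smul_vertices (g : GL (Fin 2) K) (σ.vertex 0) (σ.vertex 1)
    (σ.vertex 2)
  have hd : 0 < ((g : GL (Fin 2) K) : Matrix (Fin 2) (Fin 2) K).det := g.2
  have e : (σ.act (projComplex_isInvariant (PGLPos K)) (QuotientGroup.mk g)).triDet =
      ((g : GL (Fin 2) K) : Matrix (Fin 2) (Fin 2) K).det * σ.triDet * c ^ 2 := h
  rw [e, sgn_mul_sq _ _ (mul_ne_zero hd.ne' σ.triDet_ne_zero) hc, sgn_mul, sgn_pos hd, one_mul]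

variable (K) in
/-- The homomorphism `U_2(X) → ℤ`, `(v_0, v_1, v_2) ↦ sgn(det(v_0, v_1) α_0 α_1)`, on the
coinvariants of `PGL_+(2, K)`. -/
def eulerCoeff : Coeff (projComplex_isInvariant (K := K) (PGLPos K)) 2 →+ ℤ :=
  Coeff.lift _ eulerTriangle
    (alternating_of_swap _ fun σ i => by
      rw [eulerTriangle_eq, eulerTriangle_eq, triDet_perm, ← neg_one_mul, sgn_mul,
        sgn_neg (neg_one_lt_zero (R := K)), neg_one_mul])
    eulerTriangle_act
    (fun σ => by
      simp only [eulerTriangle_eq]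
      exact triDet_boundary sgn sgn_mul_sq sgn_add σ)

/-- The group `ℤ` of coefficients, in the universe of `K`. -/
def toZu : ℤ →+ ULift.{u} ℤ := (AddEquiv.ulift (α := ℤ)).symm.toAddMonoidHom

variable (K) in
/-- The Euler class `eu ∈ H²(PGL_+(2, K), ℤ)`. -/
def eulerClass : H2 (PGLPos K) (ULift.{u} ℤ) :=
  haveI : Infinite K := CharZero.infinite K
  H2.push (toZu.comp (eulerCoeff K))
    (tautologicalClass (projComplex_isInvariant (PGLPos K)) projComplex_isAcyclic)

/-! ### The class `eu_0` -/

theorem commonSign_mul {a b c x y z : K} (ha : 0 < a) (hb : 0 < b) (hc : 0 < c) :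
    commonSign (a * x) (b * y) (c * z) = commonSign x y z := by
  have key : ∀ {r t : K}, 0 < r → (r * t < 0 ↔ t < 0) := fun hr =>
    ⟨fun h => neg_of_mul_neg_right h hr.le, fun h => mul_neg_of_pos_of_neg hr h⟩
  simp only [commonSign, mul_pos_iff_of_pos_left, key, ha, hb, hc]

theorem commonSign_swap (x y z : K) : commonSign (-x) (-z) (-y) = -commonSign x y z := by
  simp only [commonSign, Left.neg_pos_iff, Left.neg_neg_iff]
  split_ifs <;> first | rfl | (exfalso; grind)

theorem commonSign_boundary {a b c d e f : K} (ha : a ≠ 0) (hb : b ≠ 0) (hc : c ≠ 0)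
    (hd : d ≠ 0) (he : e ≠ 0) (hf : f ≠ 0) (h : a * f - b * e + c * d = 0) :
    commonSign d f (-e) - commonSign b f (-c) + commonSign a e (-c) - commonSign a d (-b) = 0 := by
  simp only [commonSign, Left.neg_pos_iff, Left.neg_neg_iff]
  rcases lt_or_gt_of_ne ha with ha | ha <;> rcases lt_or_gt_of_ne hb with hb | hb <;>
    rcases lt_or_gt_of_ne hc with hc | hc <;> rcases lt_or_gt_of_ne hd with hd | hd <;>
    rcases lt_or_gt_of_ne he with he | he <;> rcases lt_or_gt_of_ne hf with hf | hf <;>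
    simp [ha, hb, hc, hd, he, hf, ha.not_gt, hb.not_gt, hc.not_gt, hd.not_gt, he.not_gt,
      hf.not_gt] <;>
    nlinarith

theorem ite_eq_commonSign {x : K} (h : x ≠ 0) (y w : K) :
    (if y / x < 0 ∧ w / x < 0 then sgn x else 0) = commonSign x (-y) (-w) := by
  simp only [commonSign, Left.neg_pos_iff, Left.neg_neg_iff]
  rcases lt_or_gt_of_ne h with h | h
  · simp [sgn_neg, h, h.not_gt, div_neg_iff]
  · simp [sgn_pos, h, h.not_gt, div_neg_iff]

/-- The symbol of a triangle `(v_0, v_1, v_2)` in the positive projective line: writing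
`v_2 = α_0 v_0 + α_1 v_1`, it is the sign of `det(v_0, v_1)` if both `α_0` and `α_1` are negative,
and `0` otherwise. -/
def zeroTriangle (σ : OrderedSimplex (rayComplex K) 2) : ℤ :=
  let v : Fin 3 → Fin 2 → K := fun i => (σ.vertex i).someVector
  let α : Fin 2 → K := coord (v 0) (v 1) (v 2)
  if α 0 < 0 ∧ α 1 < 0 then sgn (det2 (v 0) (v 1)) else 0

theorem zeroTriangle_eq (σ : OrderedSimplex (rayComplex K) 2) :
    zeroTriangle σ = commonSign (det2 (σ.vertex 0).someVector (σ.vertex 1).someVector)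
      (det2 (σ.vertex 1).someVector (σ.vertex 2).someVector)
      (-det2 (σ.vertex 0).someVector (σ.vertex 2).someVector) := by
  have h : det2 (σ.vertex 0).someVector (σ.vertex 1).someVector ≠ 0 :=
    det2_someVector_ne_zero σ (by decide)
  have key := ite_eq_commonSign h (-det2 (σ.vertex 1).someVector (σ.vertex 2).someVector)
    (det2 (σ.vertex 0).someVector (σ.vertex 2).someVector)
  rw [neg_neg, ← det2_swap (σ.vertex 1).someVector (σ.vertex 2).someVector] at key
  exact key

theorem zeroTriangle_act (g : PposGLPos K) (σ : OrderedSimplex (rayComplex K) 2) :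
    zeroTriangle (σ.act rayComplex_isInvariant g) = zeroTriangle σ := by
  rw [zeroTriangle_eq, zeroTriangle_eq]
  induction g using QuotientGroup.induction_on with | H g =>
  have hd : 0 < ((g : GL (Fin 2) K) : Matrix (Fin 2) (Fin 2) K).det := g.2
  have key : ∀ i j, ∃ c : K, 0 < c ∧
      det2 (g • σ.vertex i).someVector (g • σ.vertex j).someVector =
        c * det2 (σ.vertex i).someVector (σ.vertex j).someVector := by
    intro i j
    obtain ⟨a, ha, ha'⟩ := ray_smul_someVector g (σ.vertex i)
    obtain ⟨b, hb, hb'⟩ := ray_smul_someVector g (σ.vertex j)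
    exact ⟨a * b * ((g : GL (Fin 2) K) : Matrix (Fin 2) (Fin 2) K).det,
      mul_pos (mul_pos ha hb) hd, by rw [ha', hb', det2_smul_smul, det2_mulVec]; ring⟩
  obtain ⟨a, ha, ha'⟩ := key 0 1
  obtain ⟨b, hb, hb'⟩ := key 1 2
  obtain ⟨c, hc, hc'⟩ := key 0 2
  change commonSign (det2 (g • σ.vertex 0).someVector (g • σ.vertex 1).someVector)
    (det2 (g • σ.vertex 1).someVector (g • σ.vertex 2).someVector)
    (-det2 (g • σ.vertex 0).someVector (g • σ.vertex 2).someVector) = _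
  rw [ha', hb', hc', ← mul_neg, commonSign_mul ha hb hc]

theorem zeroTriangle_perm (σ : OrderedSimplex (rayComplex K) 2) (i : Fin 2) :
    zeroTriangle (σ.perm (Equiv.swap i.castSucc i.succ)) = -zeroTriangle σ := by
  rw [zeroTriangle_eq, zeroTriangle_eq, ← commonSign_swap]
  fin_cases i
  · change commonSign (det2 (σ.vertex 1).someVector (σ.vertex 0).someVector)
      (det2 (σ.vertex 0).someVector (σ.vertex 2).someVector)
      (-det2 (σ.vertex 1).someVector (σ.vertex 2).someVector) = _
    rw [det2_swap (σ.vertex 0).someVector (σ.vertex 1).someVector, neg_neg]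
  · change commonSign (det2 (σ.vertex 0).someVector (σ.vertex 2).someVector)
      (det2 (σ.vertex 2).someVector (σ.vertex 1).someVector)
      (-det2 (σ.vertex 0).someVector (σ.vertex 1).someVector) = _
    rw [det2_swap (σ.vertex 1).someVector (σ.vertex 2).someVector, neg_neg, commonSign_cycle, commonSign_cycle,
      commonSign_cycle, commonSign_cycle]

theorem zeroTriangle_boundary (σ : OrderedSimplex (rayComplex K) 3) :
    ∑ i : Fin 4, (-1 : ℤ) ^ (i : ℕ) • zeroTriangle (σ.face i) = 0 := by
  simp only [zeroTriangle_eq]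
  have h : ∀ {i j : Fin 4}, i ≠ j →
      det2 (σ.vertex i).someVector (σ.vertex j).someVector ≠ 0 :=
    fun hij => det2_someVector_ne_zero σ hij
  have key := commonSign_boundary (h (i := 0) (j := 1) (by decide))
    (h (i := 0) (j := 2) (by decide)) (h (i := 0) (j := 3) (by decide))
    (h (i := 1) (j := 2) (by decide)) (h (i := 1) (j := 3) (by decide))
    (h (i := 2) (j := 3) (by decide)) (det2_plucker _ _ _ _)
  rw [Fin.sum_univ_four]
  simp only [Fin.val_zero, Fin.val_one, pow_zero, pow_one, one_smul, neg_smul,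
    show ((2 : Fin 4) : ℕ) = 2 from rfl, show ((3 : Fin 4) : ℕ) = 3 from rfl,
    show (-1 : ℤ) ^ 2 = 1 by norm_num, show (-1 : ℤ) ^ 3 = -1 by norm_num]
  exact key

variable (K) in
/-- The homomorphism `U_2(X_+) → ℤ` on the coinvariants of `P_+GL_+(2, K)` given on triangles by
`zeroTriangle`. -/
def zeroCoeff : Coeff (rayComplex_isInvariant (K := K)) 2 →+ ℤ :=
  Coeff.lift _ zeroTriangle (alternating_of_swap _ zeroTriangle_perm) zeroTriangle_act
    zeroTriangle_boundary

variable (K) in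
/-- The class `eu_0 ∈ H²(P_+GL_+(2, K), ℤ)`: the image of the tautological class under the
projection of `U_2(X_+)` onto the summand of triangles with `α_0, α_1 < 0`. -/
def eulerClassZero : H2 (PposGLPos K) (ULift.{u} ℤ) :=
  H2.push (toZu.comp (zeroCoeff K))
    (tautologicalClass rayComplex_isInvariant rayComplex_isAcyclic)

end Symbols

end

end FlatEuler

/-! Each class is represented by a cocycle `(g, h) ↦ f(T(ψ(1, g, gh)))`, where `ψ` is some
equivariant chain map and `f` a homomorphism on coinvariants. Two augmentation-preserving chain maps
from the standard resolution of `G` into an acyclic complex, both equivariant along the same `φ : G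
→ H`, are equivariantly homotopic. Since `f ∘ T` is invariant and kills boundaries, its pull-backs
along the two differ by a coboundary (`EquivariantChainMap.exists_coboundary`). Both equalities
thereby reduce to identities between functions on triangles.

For the first, the complex is the same and only the group changes. In terms of `λ = det(u, v) det(v,
w) det(w, u)`, the Witt symbol is `[λ]` and the Euler symbol is `sgn λ`; since `σ[λ] = sgn λ`
(`signature_wittSymbol`), the two cocycles agree on every chain (`signature_wittCoeff`).

For the second, sending a ray to its line gives a simplicial map `X_+ → X`, injective on simplices
and compatible with the groups, so the Euler cocycle may be computed on `X_+`. For a triangle of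
rays put `x = det(u, v)`, `y = det(v, w)`, `z = det(w, u)`. The Euler symbol is `sgn(xyz)`, while
the symbol of `eu_0` is the common sign of `x, y, z`, or `0` if they disagree, because `α_1 = -y/x`
and `α_2 = -z/x`. The elementary identity `sgn(xyz) + (sgn x + sgn y + sgn z) = 4 · commonSign(x, y,
z)` (`sgn_mul_add_sum_eq_commonSign`) finishes the argument: the bracket is the coboundary of the
cochain `(u, v) ↦ sgn det(u, v)`. That cochain is invariant under positive determinants and well
defined on rays, but not on lines; hence the passage to `X_+` and to `SL(2, K)`. -/

namespace FlatEuler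

noncomputable section

/-! ### Chain maps equivariant along a homomorphism -/

section Homotopy

variable {G H V : Type u} [Group G] [Group H] [MulAction H V] {X : AbstractSimplicialComplex V}

/-- An augmentation-preserving chain map from the standard homogeneous resolution of `G` to the
chains of a complex acted on by `H`, equivariant along a homomorphism `φ : G → H`. -/
structure EquivariantChainMap (φ : G →* H) (hH : IsInvariant H X) where
  toFun : (n : ℕ) → (Fin (n + 1) → G) → Chain X n
  equivariant : ∀ (n : ℕ) (g : G) (t : Fin (n + 1) → G),
    toFun n (fun i => g * t i) = Chain.act hH (φ g) (toFun n t)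
  augmentation_eq : ∀ t : Fin 1 → G, augmentation X (toFun 0 t) = 1
  boundary_eq : ∀ (n : ℕ) (t : Fin (n + 2) → G),
    boundary n (toFun (n + 1) t) =
      ∑ i : Fin (n + 2), (-1 : ℤ) ^ (i : ℕ) • toFun n (fun j => t (i.succAbove j))

/-- A chain map from the standard resolution of `H`, precomposed with `φ : G → H`. -/
def StandardChainMap.comp {hH : IsInvariant H X} (ψ : StandardChainMap hH) (φ : G →* H) :
    EquivariantChainMap φ hH where
  toFun n t := ψ.toFun n fun i => φ (t i)
  equivariant n g t := by simp only [map_mul, ψ.equivariant]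
  augmentation_eq t := ψ.augmentation_eq _
  boundary_eq n t := ψ.boundary_eq n _

/-- `G` acts freely on tuples, and every tuple `t` is the translate by `t 0` of a tuple starting
with `1`. So lifts are chosen arbitrarily on the latter and transported by `φ (t 0)`. The degrees
`n` and `m` are independent because a homotopy raises the degree by one. -/
theorem exists_equivariant_lift_along (φ : G →* H) (hH : IsInvariant H X)
    {n m : ℕ} {D : Type*} (b : Chain X m → D) (act : H → D → D)
    (hb : ∀ g c, b (Chain.act hH g c) = act g (b c))
    (z : (Fin (n + 1) → G) → D) (hz : ∀ g t, z (fun i => g * t i) = act (φ g) (z t))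
    (hex : ∀ t, ∃ c, b c = z t) :
    ∃ q : (Fin (n + 1) → G) → Chain X m,
      (∀ g t, q (fun i => g * t i) = Chain.act hH (φ g) (q t)) ∧ ∀ t, b (q t) = z t := by
  choose r hr using hex
  refine ⟨fun t => Chain.act hH (φ (t 0)) (r fun i => (t 0)⁻¹ * t i), fun g t => ?_, fun t => ?_⟩
  · have e : (fun i => (g * t 0)⁻¹ * (g * t i)) = fun i => (t 0)⁻¹ * t i :=
      funext fun i => by rw [mul_inv_rev, mul_assoc, inv_mul_cancel_left]
    dsimp only
    rw [e, map_mul, Chain.act_mul]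
  · have e : (fun i => t 0 * ((t 0)⁻¹ * t i)) = t := funext fun i => mul_inv_cancel_left _ _
    dsimp only
    rw [hb, hr, ← hz, e]

/-- Two equivariant chain maps into an acyclic complex differ, in degree two and up to boundaries,
by the homogeneous coboundary of an equivariant cochain. -/
theorem EquivariantChainMap.exists_homotopy {φ : G →* H} {hH : IsInvariant H X} (hX : IsAcyclic X)
    (ψ ψ' : EquivariantChainMap φ hH) : ∃ q : (Fin 2 → G) → Chain X 2,
      (∀ g t, q (fun i => g * t i) = Chain.act hH (φ g) (q t)) ∧
      ∀ t : Fin 3 → G, ∃ c : Chain X 3, boundary 2 c = ψ'.toFun 2 t - ψ.toFun 2 t -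
        ∑ i : Fin 3, (-1 : ℤ) ^ (i : ℕ) • q (fun j => t (i.succAbove j)) := by
  -- Degree zero of the homotopy: `∂p = ψ'_0 - ψ_0`, solvable because both augmentations are `1`.
  obtain ⟨p, hp, hp'⟩ := exists_equivariant_lift_along φ hH (boundary 0)
    (fun g => Chain.act hH g) (fun g c => boundary_act hH g c)
    (fun t => ψ'.toFun 0 t - ψ.toFun 0 t)
    (fun g t => by simp only [map_sub, ψ.equivariant, ψ'.equivariant])
    (fun t => hX.exact_zero _ (by
      rw [map_sub, ψ.augmentation_eq, ψ'.augmentation_eq, sub_self]))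
  -- Degree one: `∂q = ψ'_1 - ψ_1 - p∂`, whose right-hand side is a cycle by the equation for `p`.
  obtain ⟨q, hq, hq'⟩ := exists_equivariant_lift_along φ hH (boundary 1)
    (fun g => Chain.act hH g) (fun g c => boundary_act hH g c)
    (fun t => ψ'.toFun 1 t - ψ.toFun 1 t -
      ∑ i : Fin 2, (-1 : ℤ) ^ (i : ℕ) • p (fun j => t (i.succAbove j)))
    (fun g t => by
      simp only [map_sub, map_sum, map_zsmul, ψ.equivariant, ψ'.equivariant]
      exact congrArg _ (Finset.sum_congr rfl fun i _ => congrArg _ (hp g _)))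
    (fun t => hX.exact_succ 0 _ (by
      simp only [map_sub, map_sum, map_zsmul, ψ.boundary_eq, ψ'.boundary_eq, hp', smul_sub,
        Finset.sum_sub_distrib, sub_self]))
  -- In the last degree mere existence of a filling suffices, without equivariance, since the
  -- cocycles applied later vanish on boundaries. The remaining cycle condition comes down to `p∂∂ =
  -- 0`, which is `sum_face_face`.
  refine ⟨q, hq, fun t => hX.exact_succ 1 _ ?_⟩
  simp only [map_sub, map_sum, map_zsmul, ψ.boundary_eq, ψ'.boundary_eq, hq', smul_sub,
    Finset.sum_sub_distrib]
  rw [sum_face_face, sub_zero, sub_self]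

/-- Passage from homogeneous to inhomogeneous coboundaries. Of the faces of `(1, g, gh)` only the
zeroth, `(g, gh) = g(1, h)`, does not begin with `1`; invariance of `f` is needed there alone. -/
theorem sum_faces_bar {A : Type*} [AddCommGroup A] (f : (Fin 2 → G) → A)
    (hf : ∀ g t, f (fun i => g * t i) = f t) (g h : G) :
    ∑ i : Fin 3, (-1 : ℤ) ^ (i : ℕ) •
      f (fun j => (![1, g, g * h] : Fin 3 → G) (i.succAbove j)) =
        f ![1, h] - f ![1, g * h] + f ![1, g] := by
  have e0 : (fun k : Fin 2 => (![1, g, g * h] : Fin 3 → G) ((0 : Fin 3).succAbove k)) =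
      fun i => g * (![1, h] : Fin 2 → G) i := by
    funext k; fin_cases k <;> simp [Fin.succAbove]
  have e1 : (fun k : Fin 2 => (![1, g, g * h] : Fin 3 → G) ((1 : Fin 3).succAbove k)) =
      ![1, g * h] := by
    funext k; fin_cases k <;> rfl
  have e2 : (fun k : Fin 2 => (![1, g, g * h] : Fin 3 → G) ((2 : Fin 3).succAbove k)) =
      ![1, g] := by
    funext k; fin_cases k <;> rfl
  rw [Fin.sum_univ_three, e0, e1, e2, hf]
  simp [sub_eq_add_neg]

/-- An invariant cocycle on an acyclic complex, pulled back along two equivariant chain maps. -/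
theorem EquivariantChainMap.exists_coboundary {φ : G →* H} {hH : IsInvariant H X}
    (hX : IsAcyclic X) (ψ ψ' : EquivariantChainMap φ hH) {A : Type*} [AddCommGroup A]
    (f : Coeff hH 2 →+ A) :
    ∃ b : G → A, ∀ g h, f (tautological hH 2 (ψ.toFun 2 ![1, g, g * h])) =
      f (tautological hH 2 (ψ'.toFun 2 ![1, g, g * h])) + (b h - b (g * h) + b g) := by
  -- The order of the arguments makes the homotopy bound `ψ - ψ'`, which gives the sign of the
  -- coboundary. The cochain `b` is the value of `f ∘ T` on the homotopy at `(1, g)`.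
  obtain ⟨q, hq, hq'⟩ := ψ'.exists_homotopy hX ψ
  refine ⟨fun g => f (tautological hH 2 (q ![1, g])), fun g h => ?_⟩
  obtain ⟨c, hc⟩ := hq' ![1, g, g * h]
  have key := congrArg f (tautological_boundary hH 2 c)
  rw [hc] at key
  simp only [map_sub, map_sum, map_zsmul, map_zero] at key
  rw [sum_faces_bar (fun t => f (tautological hH 2 (q t)))
    (fun g t => by rw [hq, tautological_act])] at key
  rw [← sub_eq_iff_eq_add', ← sub_eq_zero]
  exact key

end Homotopy

/-! ### Classes and cocycles -/

section Cocycles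

open groupCohomology

variable {G H : Type u} [Group G] [Group H] {A B : Type u} [AddCommGroup A] [AddCommGroup B]

/-- Inhomogeneous `2`-cocycles with values in a trivial module. -/
abbrev Cocycle (G A : Type u) [Group G] [AddCommGroup A] : Type u :=
  cocycles₂ (Rep.trivial (ULift.{u} ℤ) G A)

/-- The class of a `2`-cocycle. -/
abbrev Cocycle.toH2 (z : Cocycle G A) : H2 G A := H2π (Rep.trivial (ULift.{u} ℤ) G A) z

/-- The action on `A` is trivial, so the term `g • b h` of the usual coboundary is just `b h`. -/
theorem Cocycle.toH2_eq (z z' : Cocycle G A) (b : G → A)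
    (h : ∀ g h, z (g, h) = z' (g, h) + (b h - b (g * h) + b g)) : z.toH2 = z'.toH2 := by
  refine (H2π_eq_iff z z').2 ⟨b, funext fun gh => ?_⟩
  exact (sub_eq_iff_eq_add'.2 (h gh.1 gh.2)).symm

/-- Naturality of the map from cocycles to classes. Here and in `Cocycle.push_toH2` only the values
of the representing cocycle matter later, so it is hidden behind an existential. -/
theorem Cocycle.pull_toH2 (φ : G →* H) (z : Cocycle H A) :
    ∃ z' : Cocycle G A, H2.pull φ z.toH2 = z'.toH2 ∧ ∀ g h, z' (g, h) = z (φ g, φ h) :=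
  ⟨_, congrArg (fun f => f.hom z) (H2π_comp_map φ
    (𝟙 (Rep.trivial (ULift.{u} ℤ) G A) : Rep.res φ (Rep.trivial (ULift.{u} ℤ) H A) ⟶ _)),
    fun _ _ => rfl⟩

theorem Cocycle.push_toH2 (f : A →+ B) (z : Cocycle G A) :
    ∃ z' : Cocycle G B, H2.push f z.toH2 = z'.toH2 ∧ ∀ g h, z' (g, h) = f (z (g, h)) :=
  ⟨_, congrArg (fun f => f.hom z) (H2π_comp_map (MonoidHom.id G)
    ((Rep.trivialFunctor (ULift.{u} ℤ) G).map (ModuleCat.ofHom (toULiftIntLinear f)))),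
    fun _ _ => rfl⟩

variable {V : Type u} [MulAction G V] {X : AbstractSimplicialComplex V}

/-- The chain map defining the tautological class is an arbitrary choice. Nothing is retained about
`ψ` except that it is a chain map; the homotopy argument needs no more. -/
theorem exists_push_tautologicalClass (hG : IsInvariant G X) (hX : IsAcyclic X)
    (f : Coeff hG 2 →+ A) :
    ∃ (ψ : StandardChainMap hG) (z : Cocycle G A),
      H2.push f (tautologicalClass hG hX) = z.toH2 ∧
      ∀ g h, z (g, h) = f (tautological hG 2 (ψ.toFun 2 ![1, g, g * h])) := by
  obtain ⟨z, hz, hz'⟩ := Cocycle.push_toH2 f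
    (tautologicalCocycle (nonempty_standardChainMap hG hX).some)
  exact ⟨_, z, hz, hz'⟩

end Cocycles

/-! ### Simplicial maps -/

section SimplicialMap

variable {V W : Type u} {X : AbstractSimplicialComplex V} {Y : AbstractSimplicialComplex W}

open Classical in
/-- `f` is a simplicial map which is injective on every simplex. -/
structure IsNondegenerateMap (X : AbstractSimplicialComplex V) (Y : AbstractSimplicialComplex W)
    (f : V → W) : Prop where
  injOn : ∀ s ∈ X.faces, Set.InjOn f s
  image_mem : ∀ s ∈ X.faces, s.image f ∈ Y.faces

variable {f : V → W}

/-- The image of an ordered simplex under a non-degenerate simplicial map. -/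
def OrderedSimplex.map (hf : IsNondegenerateMap X Y f) {n : ℕ} (σ : OrderedSimplex X n) :
    OrderedSimplex Y n :=
  ⟨⟨fun i => f (σ.1 i), fun i j h => σ.1.injective (hf.injOn _ σ.2
      (Finset.mem_coe.2 (Finset.mem_map_of_mem _ (Finset.mem_univ i)))
      (Finset.mem_coe.2 (Finset.mem_map_of_mem _ (Finset.mem_univ j))) h)⟩, by
    classical
    convert hf.image_mem _ σ.2 using 1
    ext x
    simp only [Finset.mem_map, Finset.mem_image, Finset.mem_univ, true_and,
      exists_exists_eq_and]
    rfl⟩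

/-- The map on chains induced by a non-degenerate simplicial map. -/
def Chain.map (hf : IsNondegenerateMap X Y f) {n : ℕ} : Chain X n →+ Chain Y n :=
  Chain.lift (fun σ => Chain.of (σ.map hf)) fun σ t => Chain.of_perm (σ.map hf) t

theorem Chain.map_of (hf : IsNondegenerateMap X Y f) {n : ℕ} (σ : OrderedSimplex X n) :
    Chain.map hf (Chain.of σ) = Chain.of (σ.map hf) :=
  Chain.lift_of _ _ _

theorem boundary_map (hf : IsNondegenerateMap X Y f) {n : ℕ} (c : Chain X (n + 1)) :
    boundary n (Chain.map hf c) = Chain.map hf (boundary n c) := by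
  refine DFunLike.congr_fun (f := (boundary n).comp (Chain.map hf))
    (g := (Chain.map hf).comp (boundary n)) (Chain.hom_ext fun σ => ?_) c
  rw [AddMonoidHom.comp_apply, AddMonoidHom.comp_apply, Chain.map_of, boundary_of, boundary_of,
    map_sum]
  refine Finset.sum_congr rfl fun i _ => ?_
  rw [map_zsmul, Chain.map_of]
  rfl

theorem augmentation_map (hf : IsNondegenerateMap X Y f) (c : Chain X 0) :
    augmentation Y (Chain.map hf c) = augmentation X c := by
  refine DFunLike.congr_fun (f := (augmentation Y).comp (Chain.map hf))
    (g := augmentation X) (Chain.hom_ext fun σ => ?_) c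
  rw [AddMonoidHom.comp_apply, Chain.map_of, augmentation_of, augmentation_of]

theorem Chain.map_act {G H : Type u} [Group G] [Group H] [MulAction G V] [MulAction H W]
    (hG : IsInvariant G X) (hH : IsInvariant H Y) (hf : IsNondegenerateMap X Y f) {g : G} {h : H}
    (hgh : ∀ v : V, f (g • v) = h • f v) {n : ℕ} (c : Chain X n) :
    Chain.map hf (Chain.act hG g c) = Chain.act hH h (Chain.map hf c) := by
  refine DFunLike.congr_fun (f := (Chain.map hf).comp (Chain.act hG g))
    (g := (Chain.act hH h).comp (Chain.map hf)) (Chain.hom_ext fun σ => ?_) c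
  rw [AddMonoidHom.comp_apply, AddMonoidHom.comp_apply, Chain.act_of, Chain.map_of, Chain.map_of,
    Chain.act_of]
  exact congrArg _ (OrderedSimplex.ext fun i => hgh _)

/-- The composition of an equivariant chain map with a simplicial map. -/
def EquivariantChainMap.map {Γ G H : Type u} [Group Γ] [Group G] [Group H] [MulAction G V]
    [MulAction H W] {φ : Γ →* G} {hG : IsInvariant G X} (ψ : EquivariantChainMap φ hG)
    (hH : IsInvariant H Y) (χ : Γ →* H) (hf : IsNondegenerateMap X Y f)
    (hφ : ∀ (g : Γ) (v : V), f (φ g • v) = χ g • f v) : EquivariantChainMap χ hH where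
  toFun n t := Chain.map hf (ψ.toFun n t)
  equivariant n g t := by rw [ψ.equivariant, Chain.map_act hG hH hf (hφ g)]
  augmentation_eq t := by rw [augmentation_map, ψ.augmentation_eq]
  boundary_eq n t := by simp only [boundary_map, ψ.boundary_eq, map_sum, map_zsmul]

/-- Composing with the identity map changes the acting group while keeping the chains; this is how a
chain map for `PSL(2, K)` becomes one equivariant along the inclusion into `PGL_+(2, K)`. -/
theorem isNondegenerateMap_id : IsNondegenerateMap X X id where
  injOn _ _ := Set.injOn_id _
  image_mem s hs := by
    classical
    rwa [Finset.image_id]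

theorem Chain.map_id {n : ℕ} (c : Chain X n) :
    Chain.map isNondegenerateMap_id c = c :=
  DFunLike.congr_fun (f := Chain.map isNondegenerateMap_id) (g := AddMonoidHom.id _)
    (Chain.hom_ext fun σ => Chain.map_of _ σ) c

end SimplicialMap

/-! ### The signature of a symbol -/

section Signature

variable {K : Type u} [Field K] [LinearOrder K] [IsStrictOrderedRing K]

theorem signature_of (A : SymForm K) :
    signature K (WittGroup.of A) = (sigPos A.quadratic : ℤ) - (sigNeg A.quadratic : ℤ) := by
  change FreeAbelianGroup.lift _ (FreeAbelianGroup.of A) = _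
  rw [FreeAbelianGroup.lift_apply_of]

/-- The whole line is positive definite, so `sigPos` is at least `1`; as `sigPos` and `sigNeg` add
up to the dimension `1`, `sigNeg` vanishes. -/
theorem signature_wittSymbol_of_pos {a : K} (ha : 0 < a) : signature K (wittSymbol a) = 1 := by
  rw [wittSymbol_of_ne ha.ne', signature_of]
  have ha' : ∀ i, (![a] : Fin 1 → K) i ≠ 0 := by simpa using ha.ne'
  have h1 : sigPos (SymForm.diagonal ![a] ha').quadratic +
    sigNeg (SymForm.diagonal ![a] ha').quadratic = 1 := SymForm.sigPos_add_sigNeg _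
  have h2 : ((SymForm.diagonal ![a] ha').quadratic.restrict ⊤).PosDef := by
    rintro ⟨x : Fin 1 → K, _⟩ hx
    have hx0 : x 0 ≠ 0 := fun h => hx (Subtype.ext (funext fun i => by
      rw [Subsingleton.elim (α := Fin 1) i 0]; exact h))
    have e : (SymForm.diagonal ![a] ha').form x x = a * x 0 * x 0 :=
      (SymForm.diagonal_form ![a] _ x x).trans (Fin.sum_univ_one _)
    change 0 < (SymForm.diagonal ![a] ha').form x x
    rw [e, mul_assoc]
    exact mul_pos ha (mul_self_pos.2 hx0)
  have h3 := le_sigPos_of_posDef _ h2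
  have h4 : Module.finrank K (⊤ : Submodule K (Fin (SymForm.diagonal ![a] ha').dim → K)) = 1 := by
    rw [finrank_top, Module.finrank_fin_fun]
    rfl
  omega

/-- The negative case follows from `[-a] = -[a]` in the Witt group, so no negative definite subspace
has to be computed. -/
theorem signature_wittSymbol {a : K} (ha : a ≠ 0) : signature K (wittSymbol a) = sgn a := by
  rcases lt_or_gt_of_ne ha with h | h
  · rw [← neg_neg a, wittSymbol_neg (neg_ne_zero.2 ha), map_neg,
      signature_wittSymbol_of_pos (neg_pos.2 h), neg_neg, sgn_neg h]
  · rw [signature_wittSymbol_of_pos h, sgn_pos h]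

end Signature

/-! ### From the positive projective line to the projective line -/

section Lines

variable {K : Type u} [Field K] [LinearOrder K] [IsStrictOrderedRing K]

/-- The line spanned by a ray. -/
def rayLine (p : PosProjLine K) : ProjLine K :=
  Projectivization.mk K p.someVector p.someVector_ne_zero

/-- The representatives of a ray and of its line are chosen independently, so `c` may be negative.
This does no harm, since the Euler symbol sees such scalars only through their squares. -/
theorem rayLine_rep (p : PosProjLine K) : ∃ c : K, c ≠ 0 ∧ (rayLine p).rep = c • p.someVector := by
  obtain ⟨a, ha⟩ := Projectivization.exists_smul_eq_mk_rep K p.someVector p.someVector_ne_zero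
  exact ⟨a, a.ne_zero, ha.symm⟩

/-- Two rays on the same line are linearly dependent, so opposite rays never span an edge of `X_+`.
The image condition is only non-emptiness, because `X` is a full simplex. -/
theorem rayLine_isNondegenerateMap :
    IsNondegenerateMap (rayComplex K) (projComplex K) rayLine where
  injOn s hs p hp q hq h := by
    by_contra hpq
    have h1 := (linearIndependent_iff_det2 _ _).1 (hs.2 p hp q hq hpq)
    obtain ⟨a, ha⟩ := (Projectivization.mk_eq_mk_iff' K _ _ p.someVector_ne_zero
      q.someVector_ne_zero).1 h
    rw [← ha, det2_eq] at h1
    apply h1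
    simp only [Pi.smul_apply, smul_eq_mul]
    ring
  image_mem s hs := by
    classical
    exact hs.1.image _

theorem rayLine_smul (g : Matrix.GLPos (Fin 2) K) (p : PosProjLine K) :
    rayLine (g • p) = g • rayLine p := by
  obtain ⟨c, hc, h⟩ := ray_smul_someVector g p
  change _ = Projectivization.mk K ((g : GL (Fin 2) K) • p.someVector) _
  exact (Projectivization.mk_eq_mk_iff' K _ _ _ _).2 ⟨c, h.symm⟩

theorem rayLine_equivariant (g : SL(2, K)) (p : PosProjLine K) :
    rayLine (slToPposGLPos K g • p) = (pslToPGLPos K).comp (slToPSL K) g • rayLine p :=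
  rayLine_smul (Matrix.SpecialLinearGroup.toGLPos g) p

/-! ### The sign cochain on edges of `X_+` and the factor four -/

/-- The sign of the determinant of the vertices of an edge. -/
def edgeSign (σ : OrderedSimplex (rayComplex K) 1) : ℤ :=
  sgn (det2 (σ.vertex 0).someVector (σ.vertex 1).someVector)

/-- The alternating cochain of signs of determinants of two rays. -/
def detSign : Chain (rayComplex K) 1 →+ ℤ :=
  Chain.lift edgeSign (alternating_of_swap edgeSign fun σ i => by
    obtain rfl : i = 0 := Subsingleton.elim _ _
    change sgn (det2 (σ.vertex 1).someVector (σ.vertex 0).someVector) = _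
    rw [det2_swap, ← neg_one_mul, sgn_mul, sgn_neg (neg_one_lt_zero (R := K)), neg_one_mul]
    rfl)

theorem detSign_of (σ : OrderedSimplex (rayComplex K) 1) : detSign (Chain.of σ) =
    sgn (det2 (σ.vertex 0).someVector (σ.vertex 1).someVector) :=
  Chain.lift_of _ _ _

/-- The determinant of an edge is multiplied by `det g > 0` and by the positive scalars relating
representatives of rays. With lines in place of rays these scalars could be negative. -/
theorem detSign_act (g : PposGLPos K) (c : Chain (rayComplex K) 1) :
    detSign (Chain.act rayComplex_isInvariant g c) = detSign c := by
  refine DFunLike.congr_fun (f := detSign.comp (Chain.act rayComplex_isInvariant g))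
    (g := detSign) (Chain.hom_ext fun σ => ?_) c
  rw [AddMonoidHom.comp_apply, Chain.act_of, detSign_of, detSign_of]
  induction g using QuotientGroup.induction_on with | H g =>
  have hd : 0 < ((g : GL (Fin 2) K) : Matrix (Fin 2) (Fin 2) K).det := g.2
  obtain ⟨a, ha, ha'⟩ := ray_smul_someVector g (σ.vertex 0)
  obtain ⟨b, hb, hb'⟩ := ray_smul_someVector g (σ.vertex 1)
  change sgn (det2 (g • σ.vertex 0).someVector (g • σ.vertex 1).someVector) = _
  rw [ha', hb', det2_smul_smul, det2_mulVec, sgn_mul, sgn_pos (mul_pos ha hb), sgn_mul,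
    sgn_pos hd, one_mul, one_mul]

/-- If the three signs agree, the product contributes `±1` and the sum `±3`, of the same sign.
Otherwise the sum is the majority sign and the product is its opposite, so they cancel. -/
theorem sgn_mul_add_sum_eq_commonSign {x y z : K} (hx : x ≠ 0) (hy : y ≠ 0) (hz : z ≠ 0) :
    sgn (x * y * z) + (sgn x + sgn y + sgn z) = 4 * commonSign x y z := by
  rw [sgn_mul, sgn_mul]
  rcases lt_or_gt_of_ne hx with hx | hx <;> rcases lt_or_gt_of_ne hy with hy | hy <;>
    rcases lt_or_gt_of_ne hz with hz | hz <;>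
    simp [commonSign, sgn_pos, sgn_neg, hx, hy, hz, hx.not_gt, hy.not_gt, hz.not_gt]

/-- This is `sgn_mul_add_sum_eq_commonSign` for the three determinants taken in cyclic order; the
sum of their signs is the coboundary of `detSign` on the triangle. -/
theorem eulerTriangle_map (σ : OrderedSimplex (rayComplex K) 2) :
    eulerTriangle (σ.map rayLine_isNondegenerateMap) + detSign (boundary 1 (Chain.of σ)) =
      4 * zeroTriangle σ := by
  set p := (σ.vertex 0).someVector with hp
  set q := (σ.vertex 1).someVector with hq
  set r := (σ.vertex 2).someVector with hr
  have h01 : det2 p q ≠ 0 := det2_someVector_ne_zero σ (by decide : (0 : Fin 3) ≠ 1)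
  have h12 : det2 q r ≠ 0 := det2_someVector_ne_zero σ (by decide : (1 : Fin 3) ≠ 2)
  have h02 : det2 p r ≠ 0 := det2_someVector_ne_zero σ (by decide : (0 : Fin 3) ≠ 2)
  obtain ⟨a, ha, ha'⟩ := rayLine_rep (σ.vertex 0)
  obtain ⟨b, hb, hb'⟩ := rayLine_rep (σ.vertex 1)
  obtain ⟨c, hc, hc'⟩ := rayLine_rep (σ.vertex 2)
  have e : eulerTriangle (σ.map rayLine_isNondegenerateMap) = sgn (triDet p q r) := by
    rw [eulerTriangle_eq]
    change sgn (triDet (rayLine (σ.vertex 0)).rep (rayLine (σ.vertex 1)).rep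
      (rayLine (σ.vertex 2)).rep) = _
    rw [ha', hb', hc', triDet_smul,
      sgn_mul_sq _ _ (triDet_ne_zero h01 h12 h02) (mul_ne_zero (mul_ne_zero ha hb) hc)]
  have e' : detSign (boundary 1 (Chain.of σ)) =
      sgn (det2 q r) - sgn (det2 p r) + sgn (det2 p q) := by
    rw [boundary_of, map_sum, Fin.sum_univ_three]
    simp only [map_zsmul, detSign_of]
    change (1 : ℤ) • sgn (det2 q r) + (-1 : ℤ) ^ 1 • sgn (det2 p r) +
      (-1 : ℤ) ^ 2 • sgn (det2 p q) = _
    norm_num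
    ring
  -- The third argument is `-det(p, r) = det(r, p)`. The boundary contains the edge `(p, r)` with
  -- coefficient `-1`, so the signs match because `sgn` is odd.
  have e'' := sgn_mul_add_sum_eq_commonSign h01 h12 (neg_ne_zero.2 h02)
  have h4 : sgn (-det2 p r) = -sgn (det2 p r) := by
    rw [← neg_one_mul, sgn_mul, sgn_neg (neg_one_lt_zero (R := K)), neg_one_mul]
  rw [zeroTriangle_eq, ← e'', e, e', triDet, det2_swap p r, h4]
  ring

/-- Additive extension to chains, needed because the chain map may send a tuple to a combination of
simplices. -/
theorem eulerCoeff_map (c : Chain (rayComplex K) 2) :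
    eulerCoeff K (tautological _ 2 (Chain.map rayLine_isNondegenerateMap c)) +
      detSign (boundary 1 c) = 4 * zeroCoeff K (tautological _ 2 c) := by
  refine DFunLike.congr_fun
    (f := ((eulerCoeff K).comp ((tautological _ 2).comp
      (Chain.map rayLine_isNondegenerateMap)) + detSign.comp (boundary 1)))
    (g := (AddMonoidHom.mulLeft 4).comp ((zeroCoeff K).comp (tautological _ 2)))
    (Chain.hom_ext fun σ => ?_) c
  simp only [AddMonoidHom.add_apply, AddMonoidHom.comp_apply, Chain.map_of, eulerCoeff, zeroCoeff,
    Coeff.lift_tautological, eulerTriangle_map, AddMonoidHom.coe_mulLeft]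

/-- Both sides equal `sgn` of the determinant product on a triangle. The comparison is made on
chains because the two sides use coinvariants of different groups, `PSL(2, K)` and `PGL_+(2, K)`. -/
theorem signature_wittCoeff (c : Chain (projComplex K) 2) :
    signature K (wittCoeff K (tautological _ 2 c)) = eulerCoeff K (tautological _ 2 c) := by
  refine DFunLike.congr_fun
    (f := (signature K).comp ((wittCoeff K).comp (tautological _ 2)))
    (g := (eulerCoeff K).comp (tautological _ 2)) (Chain.hom_ext fun σ => ?_) c
  have e : wittCoeff K (tautological _ 2 (Chain.of σ)) = wittTriangle σ :=
    Coeff.lift_tautological _ _ _ _ _ σ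
  simp only [AddMonoidHom.comp_apply, eulerCoeff, Coeff.lift_tautological, e, wittTriangle,
    eulerTriangle_eq, signature_wittSymbol σ.triDet_ne_zero]

theorem projLine_equivariant (g : PSL(2, K)) (p : ProjLine K) :
    g • p = pslToPGLPos K g • p := by
  induction g using QuotientGroup.induction_on with | H g =>
  rfl

end Lines

/-! ### Comparison of the classes -/

section Comparison

variable (K : Type u) [Field K] [LinearOrder K] [IsStrictOrderedRing K]

theorem pull_eulerClass_eq_push_wittClass :
    H2.pull (pslToPGLPos K) (eulerClass K) = H2.push (toZu.comp (signature K))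
      (haveI : Infinite K := CharZero.infinite K; wittClass K) := by
  have : Infinite K := CharZero.infinite K
  obtain ⟨ψ, z, hz, hz'⟩ := exists_push_tautologicalClass (projComplex_isInvariant (PGLPos K))
    projComplex_isAcyclic (toZu.comp (eulerCoeff K))
  obtain ⟨ψ', w, hw, hw'⟩ := exists_push_tautologicalClass
    (projComplex_isInvariant (K := K) PSL(2, K)) projComplex_isAcyclic (wittCoeff K)
  obtain ⟨x, hx, hx'⟩ := Cocycle.pull_toH2 (pslToPGLPos K) z
  obtain ⟨y, hy, hy'⟩ := Cocycle.push_toH2 (toZu.comp (signature K)) w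
  rw [eulerClass, hz, hx, wittClass, hw, hy]
  -- `θ` has the same values as `ψ'`, but is regarded as equivariant along the inclusion. It can
  -- then be compared with the restriction of `ψ`.
  let θ : EquivariantChainMap (pslToPGLPos K) (projComplex_isInvariant (PGLPos K)) :=
    (ψ'.comp (MonoidHom.id _)).map _ (pslToPGLPos K) isNondegenerateMap_id projLine_equivariant
  obtain ⟨b, hb⟩ := (ψ.comp (pslToPGLPos K)).exists_coboundary projComplex_isAcyclic θ
    (toZu.comp (eulerCoeff K))
  refine Cocycle.toH2_eq x y b fun g h => ?_
  have key := hb g h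
  have e1 : (fun i => pslToPGLPos K ((![1, g, g * h] : Fin 3 → PSL(2, K)) i)) =
      ![1, pslToPGLPos K g, pslToPGLPos K g * pslToPGLPos K h] := by
    funext i; fin_cases i <;> simp
  have e2 : θ.toFun 2 ![1, g, g * h] = ψ'.toFun 2 ![1, g, g * h] := Chain.map_id _
  rw [e2] at key
  simp only [StandardChainMap.comp, e1] at key
  rw [hx', hz', key, hy', hw']
  simp only [AddMonoidHom.comp_apply, signature_wittCoeff]

theorem pull_eulerClass_eq_four_smul :
    H2.pull (slToPSL K) (H2.pull (pslToPGLPos K) (eulerClass K)) =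
      4 • H2.pull (slToPposGLPos K) (eulerClassZero K) := by
  have : Infinite K := CharZero.infinite K
  obtain ⟨ψ, z, hz, hz'⟩ := exists_push_tautologicalClass (projComplex_isInvariant (PGLPos K))
    projComplex_isAcyclic (toZu.comp (eulerCoeff K))
  obtain ⟨ψ', w, hw, hw'⟩ := exists_push_tautologicalClass (rayComplex_isInvariant (K := K))
    rayComplex_isAcyclic (toZu.comp (zeroCoeff K))
  obtain ⟨x, hx, hx'⟩ := Cocycle.pull_toH2 (pslToPGLPos K) z
  obtain ⟨x₁, hx₁, hx₁'⟩ := Cocycle.pull_toH2 (slToPSL K) x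
  obtain ⟨y, hy, hy'⟩ := Cocycle.pull_toH2 (slToPposGLPos K) w
  -- The factor `4` is moved onto the cocycle, so that two cocycle classes remain to be compared.
  rw [eulerClass, hz, hx, hx₁, eulerClassZero, hw, hy, ← map_nsmul]
  let φ : SL(2, K) →* PGLPos K := (pslToPGLPos K).comp (slToPSL K)
  let ρ := ψ'.comp (slToPposGLPos K)
  -- The chain map into `X_+` used for `eu_0`, followed by the map from rays to lines, is an
  -- admissible chain map for computing `eu` over `SL(2, K)`.
  let θ : EquivariantChainMap φ (projComplex_isInvariant (PGLPos K)) :=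
    ρ.map _ φ rayLine_isNondegenerateMap rayLine_equivariant
  obtain ⟨b, hb⟩ := (ψ.comp φ).exists_coboundary projComplex_isAcyclic θ
    (toZu.comp (eulerCoeff K))
  -- Two corrections combine: `b` accounts for the change of chain map from `ψ` to `θ`, and the sign
  -- cochain for the difference between `eu` and `4 eu_0`. It is subtracted since `eulerCoeff_map`
  -- has it on the side of `eu`.
  refine Cocycle.toH2_eq x₁ (4 • y) (fun g => b g - toZu (detSign (ρ.toFun 1 ![1, g])))
    fun g h => ?_
  have key := hb g h
  have e1 : (fun i => φ ((![1, g, g * h] : Fin 3 → SL(2, K)) i)) =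
      ![1, φ g, φ g * φ h] := by
    funext i; fin_cases i <;> simp
  have e2 : (fun i => slToPposGLPos K ((![1, g, g * h] : Fin 3 → SL(2, K)) i)) =
      ![1, slToPposGLPos K g, slToPposGLPos K g * slToPposGLPos K h] := by
    funext i; fin_cases i <;> simp
  have e3 := eulerCoeff_map (ρ.toFun 2 ![1, g, g * h])
  have e4 : ρ.toFun 2 ![1, g, g * h] = ψ'.toFun 2
      ![1, slToPposGLPos K g, slToPposGLPos K g * slToPposGLPos K h] := congrArg _ e2
  -- The boundary of `ρ(1, g, gh)` is rewritten through the faces of the tuple, so that `detSign ∘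
  -- ∂` becomes the inhomogeneous coboundary of `g ↦ detSign(ρ(1, g))`.
  rw [ρ.boundary_eq, map_sum] at e3
  simp only [map_zsmul] at e3
  rw [sum_faces_bar (fun t => detSign (ρ.toFun 1 t))
    (fun g t => by rw [ρ.equivariant, detSign_act]), e4] at e3
  have e5 : x₁ (g, h) = toZu (eulerCoeff K (tautological _ 2
      (ψ.toFun 2 ![1, φ g, φ g * φ h]))) := by
    rw [hx₁', hx', hz']; rfl
  have e6 : (4 • y) (g, h) = 4 • y (g, h) := rfl
  simp only [StandardChainMap.comp, e1] at key
  rw [e5, e6, hy', hw']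
  refine key.trans ?_
  have e7 : eulerCoeff K (tautological _ 2 (θ.toFun 2 ![1, g, g * h])) =
      4 * zeroCoeff K (tautological _ 2 (ψ'.toFun 2
        ![1, slToPposGLPos K g, slToPposGLPos K g * slToPposGLPos K h])) -
      (detSign (ρ.toFun 1 ![1, h]) - detSign (ρ.toFun 1 ![1, g * h]) +
        detSign (ρ.toFun 1 ![1, g])) := by
    rw [← e3, ← e4]
    exact (add_sub_cancel_right _ _).symm
  simp only [AddMonoidHom.comp_apply, e7, map_sub, map_add]
  -- Multiplication by the integer `4` is turned into a natural multiple, which commutes with the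
  -- additive map `toZu`.
  rw [← smul_eq_mul, ← Nat.cast_ofNat (R := ℤ) (n := 4), Nat.cast_smul_eq_nsmul, map_nsmul]
  abel

end Comparison

end

end FlatEuler

theorem theorem13p4 {K : Type*} [Field K] [LinearOrder K] [IsStrictOrderedRing K] :
    FlatEuler.H2.pull (FlatEuler.pslToPGLPos K) (FlatEuler.eulerClass K) =
        FlatEuler.H2.push (FlatEuler.toZu.comp (FlatEuler.signature K))
          (haveI : Infinite K := CharZero.infinite K; FlatEuler.wittClass K) ∧
      FlatEuler.H2.pull (FlatEuler.slToPSL K)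
          (FlatEuler.H2.pull (FlatEuler.pslToPGLPos K) (FlatEuler.eulerClass K)) =
        4 • FlatEuler.H2.pull (FlatEuler.slToPposGLPos K) (FlatEuler.eulerClassZero K) := by
  exact ⟨FlatEuler.pull_eulerClass_eq_push_wittClass K, FlatEuler.pull_eulerClass_eq_four_smul K⟩
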